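/- **Setting.** Describe an oriented generalized circle (circle or line) in the plane by inversive coordinates $(\tilde b,b,h_1,h_2)\in\mathbb R^4$ with $h_1^2+h_2^2-b\tilde b=1$, where $b$ is its signed curvature. The *square tiling configuration* consists of the circles of radius $1$ centred at $(2i,2j)$, $(i,j)\in\mathbb Z^2$ (their tangency graph is the square grid); its dual circles have radius $1$ and centres $(2i+1,2j+1)$. A *base configuration* is the image of these circles and dual circles under a Möbius transformation (possibly orientation reversing). The *square packing* $\mathcal A$ is the orbit of the base circles under the group generated by the reflections through the dual circles; the images of the whole base configuration under this group are the *square grid configurations* of $\mathcal A$. The packing is *integral* if all its curvatures are integers, and *primitive* if moreover their greatest common divisor is $1$. It has *type $(1)$* if all curvatures of the base configuration are $\equiv 1 \bmod 8$, and *full type* if, up to a symmetry of the grid, the curvatures of the base configuration are congruent mod $8$ to the doubly periodic continuation of $$\begin{matrix}1&3&7&5&5&7&3&1\\0&2&6&4&4&6&2&0\\1&3&7&5&5&7&3&1\\4&6&2&0&0&2&6&4\end{matrix}$$ **The invariant.** Let $\mathcal C$ be a circle of curvature $a$ in $\mathcal A$ and let $b,c,d,e$ be the curvatures of its left, top, right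 and bottom neighbours in a square grid configuration of $\mathcal A$ containing $\mathcal C$. Put $$Q_\alpha(x,y)=\tfrac{a+b}2x^2+\tfrac{c-e}2xy+\tfrac{a+d}2y^2,\qquad Q_\beta(x,y)=(a+b)x^2+(c-e)xy+(a+d)y^2 .$$ Call an integer $\rho$ *admissible at $\mathcal C$* if $\gcd(\rho,a)=1$ and, for some such square grid configuration and some coprime integers $x,y$ with $y\ge 0$, either $xy$ is odd and $\rho=Q_\alpha(x,y)$, or $xy$ is even and $\rho=Q_\beta(x,y)$. With the Kronecker symbol $\left(\frac{\cdot}{\cdot}\right)$ (where $\left(\frac{\pm1}{0}\right)=1$), put $$\chi_2(\mathcal C)=\begin{cases}\left(\frac{\rho}{a}\right)& a\equiv 0,1,4 \bmod 8,\\ -\left(\frac{\rho}{a}\right)& a\equiv 2,6,7\bmod 8,\\ (-1)^{\rho}\left(\frac{\rho}{a}\right)& a\equiv 3\bmod 8,\\ (-1)^{\rho+1}\left(\frac{\rho}{a}\right)& a\equiv 5\bmod 8.\end{cases}$$ **Theorem.** Let $\mathcal A$ be a primitive integral square packing of type $(1)$ or of full type. 1. At every circle of $\mathcal A$ there is an admissible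 $\rho$, and there is $\varepsilon\in\{1,-1\}$ such that $\chi_2(\mathcal C)=\varepsilon$ for every circle $\mathcal C$ of $\mathcal A$ and every choice of admissible $\rho$. Thus $\chi_2(\mathcal A):=\varepsilon$ is well defined. 2. If $\chi_2(\mathcal A)=-1$, then no integer of the form $n^2$, $n\in\mathbb Z$, is a curvature in $\mathcal A$. In particular the Local-Global Conjecture is false for $\mathcal A$: it is not true that every sufficiently large integer which, for each modulus $m\ge1$, is congruent mod $m$ to some curvature of $\mathcal A$ is itself a curvature of $\mathcal A$. -/

import Mathlib

/-! ### The Kronecker symbol -/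

/-- The Kronecker symbol `(a / b)`, multiplicative in `b ≠ 0`: the sign of `b` contributes
`(a / -1)`, which is `-1` exactly when `a < 0`; the prime `2` contributes `(a / 2) = χ₈ a`, which is
`1` for `a ≡ 1, 7`, `-1` for `a ≡ 3, 5` mod `8` and `0` for even `a`; and the odd part of `|b|`
contributes a Jacobi symbol, that is, a product of Legendre symbols.
As usual, `(a / 0)` is `1` if `a = ± 1` and `0` otherwise. -/
def kroneckerSymbol (a b : ℤ) : ℤ :=
  if b = 0 then (if a = 1 ∨ a = -1 then 1 else 0)
  else (if b < 0 ∧ a < 0 then -1 else 1) * ZMod.χ₈ (a : ZMod 8) ^ padicValNat 2 b.natAbs *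
    jacobiSym a (b.natAbs / 2 ^ padicValNat 2 b.natAbs)

/-! ### Oriented generalized circles, inversions and Möbius transformations -/

/-- An oriented generalized circle (circle or line) of the complex plane, in inversive coordinates.
For a circle with centre `z` and signed radius `r`: `curv = 1 / r`, `(h₁, h₂) = z / r`, and `cocurv`
is the curvature of the image in the unit circle. For a line, `curv = 0` and `(h₁, h₂)` is a
unit normal vector. The sign (the direction of the normal) records the orientation. -/
@[ext]
structure OrientedCircle where
  cocurv : ℝ
  curv : ℝ
  h₁ : ℝ
  h₂ : ℝ
  norm_eq : h₁ ^ 2 + h₂ ^ 2 - curv * cocurv = 1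

namespace OrientedCircle

/-- The inversive product of two oriented circles: the polarization of `h₁² + h₂² - curv * cocurv`.
It is `0` for orthogonal circles, `-1` for circles with disjoint interiors that are tangent, and
has absolute value larger than `1` for disjoint circles. -/
noncomputable def inversiveProduct (C D : OrientedCircle) : ℝ :=
  C.h₁ * D.h₁ + C.h₂ * D.h₂ - (C.curv * D.cocurv + C.cocurv * D.curv) / 2

/-- The image `C - 2 ⟨C, D⟩ D` of the circle `C` under the inversion (reflection) in `D`. -/
noncomputable def reflectFun (D C : OrientedCircle) : OrientedCircle where
  cocurv := C.cocurv - 2 * C.inversiveProduct D * D.cocurv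
  curv := C.curv - 2 * C.inversiveProduct D * D.curv
  h₁ := C.h₁ - 2 * C.inversiveProduct D * D.h₁
  h₂ := C.h₂ - 2 * C.inversiveProduct D * D.h₂
  norm_eq := by
    have hC := C.norm_eq
    have hD := D.norm_eq
    simp only [inversiveProduct]
    linear_combination hC + 4 * (C.h₁ * D.h₁ + C.h₂ * D.h₂ -
      (C.curv * D.cocurv + C.cocurv * D.curv) / 2) ^ 2 * hD

theorem reflectFun_involutive (D : OrientedCircle) : Function.Involutive (reflectFun D) := by
  intro C
  have key : (reflectFun D C).inversiveProduct D = - C.inversiveProduct D := by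
    have hD := D.norm_eq
    simp only [inversiveProduct, reflectFun]
    linear_combination (-2) * (C.h₁ * D.h₁ + C.h₂ * D.h₂ -
      (C.curv * D.cocurv + C.cocurv * D.curv) / 2) * hD
  ext
  · change (reflectFun D C).cocurv - 2 * (reflectFun D C).inversiveProduct D * D.cocurv = _
    rw [key]; simp only [reflectFun]; ring
  · change (reflectFun D C).curv - 2 * (reflectFun D C).inversiveProduct D * D.curv = _
    rw [key]; simp only [reflectFun]; ring
  · change (reflectFun D C).h₁ - 2 * (reflectFun D C).inversiveProduct D * D.h₁ = _
    rw [key]; simp only [reflectFun]; ring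
  · change (reflectFun D C).h₂ - 2 * (reflectFun D C).inversiveProduct D * D.h₂ = _
    rw [key]; simp only [reflectFun]; ring

/-- The inversion in `D`, as a permutation of the set of oriented generalized circles. -/
noncomputable def reflect (D : OrientedCircle) : Equiv.Perm OrientedCircle :=
  (reflectFun_involutive D).toPerm

end OrientedCircle

/-- The group of all Möbius transformations (orientation preserving or reversing), acting on
oriented generalized circles: it is generated by the inversions. -/
def moebiusGroup : Subgroup (Equiv.Perm OrientedCircle) :=
  Subgroup.closure (Set.range OrientedCircle.reflect)

/-! ### The square tiling and square packings -/

/-- The square grid graph on `ℤ × ℤ`. -/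
def squareGrid : SimpleGraph (ℤ × ℤ) where
  Adj p q := |p.1 - q.1| + |p.2 - q.2| = 1
  symm := ⟨fun p q h => by rw [abs_sub_comm q.1, abs_sub_comm q.2]; exact h⟩
  loopless := ⟨fun p h => by simp at h⟩

/-- The circles of the square tiling: radius `1`, centre `(2 i, 2 j)`. Their tangency graph is
the square grid. -/
def tilingCircle (p : ℤ × ℤ) : OrientedCircle where
  cocurv := (2 * p.1 : ℝ) ^ 2 + (2 * p.2 : ℝ) ^ 2 - 1
  curv := 1
  h₁ := 2 * p.1
  h₂ := 2 * p.2
  norm_eq := by ring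

/-- The dual circles of the square tiling: radius `1`, centre `(2 i + 1, 2 j + 1)`. This circle
belongs to the face of the grid with vertices `(i, j), (i + 1, j), (i, j + 1), (i + 1, j + 1)`; it
is orthogonal to the circles of these four vertices and disjoint from all the other ones. -/
def tilingDual (f : ℤ × ℤ) : OrientedCircle where
  cocurv := (2 * f.1 + 1 : ℝ) ^ 2 + (2 * f.2 + 1 : ℝ) ^ 2 - 1
  curv := 1
  h₁ := 2 * f.1 + 1
  h₂ := 2 * f.2 + 1
  norm_eq := by ring

/-- A square packing, given by a base configuration: a Möbius image of the circles and the dual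
circles of the square tiling. -/
structure SquarePacking where
  position : moebiusGroup

namespace SquarePacking

/-- The base circles. -/
def base (A : SquarePacking) (p : ℤ × ℤ) : OrientedCircle :=
  (A.position : Equiv.Perm OrientedCircle) (tilingCircle p)

/-- The dual circles. -/
def dual (A : SquarePacking) (f : ℤ × ℤ) : OrientedCircle :=
  (A.position : Equiv.Perm OrientedCircle) (tilingDual f)

/-- The square Apollonian group, generated by the reflections through the dual circles. -/
def apollonianGroup (A : SquarePacking) : Subgroup (Equiv.Perm OrientedCircle) :=
  Subgroup.closure (Set.range fun f => (A.dual f).reflect)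

/-- The circles of the packing: the orbit of the base circles under the Apollonian group. -/
def circles (A : SquarePacking) : Set OrientedCircle :=
  {C | ∃ g ∈ A.apollonianGroup, ∃ p, C = g (A.base p)}

/-- The integers that occur as curvatures in the packing. -/
def curvatures (A : SquarePacking) : Set ℤ :=
  {n | ∃ C ∈ A.circles, C.curv = (n : ℝ)}

/-- All curvatures are integers. -/
def IsIntegral (A : SquarePacking) : Prop :=
  ∀ C ∈ A.circles, ∃ n : ℤ, C.curv = (n : ℝ)

/-- The greatest common divisor of the curvatures is `1`. -/
def IsPrimitive (A : SquarePacking) : Prop :=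
  ∀ d : ℤ, (∀ n ∈ A.curvatures, d ∣ n) → IsUnit d

/-- Type `(1)`: all curvatures of the base configuration are `1` mod `8`. -/
def IsTypeOne (A : SquarePacking) : Prop :=
  ∀ p, ∃ n : ℤ, (A.base p).curv = (n : ℝ) ∧ n ≡ 1 [ZMOD 8]

/-- The pattern mod `8` of a square grid configuration of full type. It is repeated periodically
in the grid, with period `8` horizontally and `4` vertically. -/
def fullPattern : Matrix (Fin 4) (Fin 8) (ZMod 8) :=
  !![1, 3, 7, 5, 5, 7, 3, 1;
     0, 2, 6, 4, 4, 6, 2, 0;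
     1, 3, 7, 5, 5, 7, 3, 1;
     4, 6, 2, 0, 0, 2, 6, 4]

/-- Full type: up to a symmetry of the grid, the curvatures of the base configuration follow the
pattern `fullPattern` mod `8`. -/
def IsFullType (A : SquarePacking) : Prop :=
  ∃ σ : squareGrid ≃g squareGrid, ∀ i j : ℤ, ∃ n : ℤ,
    (A.base (σ (i, j))).curv = (n : ℝ) ∧ (n : ZMod 8) = fullPattern (Fin.ofNat 4 (j % 4).toNat)
      (Fin.ofNat 8 (i % 8).toNat)

/-! ### The quadratic invariant -/

/-- The form `Q_α` at a circle of curvature `a` whose four neighbours in a square grid have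
curvatures `b` (left), `c` (top), `d` (right), `e` (bottom). -/
noncomputable def formAlpha (a b c d e x y : ℝ) : ℝ :=
  (a + b) / 2 * x ^ 2 + (c - e) / 2 * (x * y) + (a + d) / 2 * y ^ 2

/-- The form `Q_β` at a circle of curvature `a` whose four neighbours in a square grid have
curvatures `b` (left), `c` (top), `d` (right), `e` (bottom). -/
def formBeta (a b c d e x y : ℝ) : ℝ :=
  (a + b) * x ^ 2 + (c - e) * (x * y) + (a + d) * y ^ 2

/-- `ρ` is represented at the circle `C` of the packing: `C` is the circle in position `(i, j)` of a
square grid configuration of the packing (an image of the base configuration under an element `g`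
of the Apollonian group), and `ρ` is `Q_α (x, y)` with `x y` odd, or `Q_β (x, y)` with `x y` even,
where `y ≥ 0` and `gcd (x, y) = 1`. -/
def Represents (A : SquarePacking) (C : OrientedCircle) (ρ : ℤ) : Prop :=
  ∃ g ∈ A.apollonianGroup, ∃ i j : ℤ, C = g (A.base (i, j)) ∧
    ∃ x y : ℤ, 0 ≤ y ∧ Int.gcd x y = 1 ∧
      ((Odd (x * y) ∧ (ρ : ℝ) = formAlpha C.curv
          (g (A.base (i - 1, j))).curv (g (A.base (i, j + 1))).curv
          (g (A.base (i + 1, j))).curv (g (A.base (i, j - 1))).curv x y) ∨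
       (Even (x * y) ∧ (ρ : ℝ) = formBeta C.curv
          (g (A.base (i - 1, j))).curv (g (A.base (i, j + 1))).curv
          (g (A.base (i + 1, j))).curv (g (A.base (i, j - 1))).curv x y))

/-- The expression that defines `χ₂` at a circle of curvature `a`, by means of `ρ`. -/
def chiTwoExpr (a ρ : ℤ) : ℤ :=
  if a % 8 = 3 then (ρ.negOnePow : ℤ) * kroneckerSymbol ρ a
  else if a % 8 = 5 then ((ρ + 1).negOnePow : ℤ) * kroneckerSymbol ρ a
  else if a % 8 = 2 ∨ a % 8 = 6 ∨ a % 8 = 7 then -kroneckerSymbol ρ a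
  else kroneckerSymbol ρ a

/-- `ε` is a value of `χ₂` at the circle `C`: it is the defining expression for some represented `ρ`
coprime to the curvature `a` of `C`. -/
def IsChiTwoAt (A : SquarePacking) (C : OrientedCircle) (ε : ℤ) : Prop :=
  ∃ a ρ : ℤ, C.curv = (a : ℝ) ∧ A.Represents C ρ ∧ Int.gcd ρ a = 1 ∧ ε = chiTwoExpr a ρ

/-- `χ₂(A) = ε`: at every circle of the packing, `χ₂` has the value `ε` and no other value. -/
def HasChiTwo (A : SquarePacking) (ε : ℤ) : Prop :=
  ∀ C ∈ A.circles, ∀ ε' : ℤ, A.IsChiTwoAt C ε' ↔ ε' = ε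

/-! ### The Local-Global Conjecture -/

/-- `n` satisfies the modular restrictions: for every modulus it is congruent to a curvature. -/
def IsAdmissible (A : SquarePacking) (n : ℤ) : Prop :=
  ∀ m : ℕ, 0 < m → ∃ c ∈ A.curvatures, c ≡ n [ZMOD m]

/-- The assertion of the Local-Global Conjecture for `A`: every sufficiently large integer that
satisfies the modular restrictions is a curvature. -/
def LocalGlobal (A : SquarePacking) : Prop :=
  ∃ N : ℤ, ∀ n : ℤ, N ≤ n → A.IsAdmissible n → n ∈ A.curvatures

end SquarePacking

/-!
The curvature of the image of a circle under a Möbius transformation is a linear functional of the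
inversive coordinates, given by a future-directed null vector (`moebius_curv`). Hence the curvatures
of a square grid configuration are `a + b i + c j + e (i² - i + j² - j)`, with four integers that
are recorded in `GridData` and satisfy one quadratic equation. Every configuration of the packing
arises from the base configuration by inversions in dual circles of the tiling (`exists_tilingGroup`).
On `GridData`, the changes of the point of view within a configuration and these inversions are
generated by four simple moves: `swap`, `mirror`, `star` and `flip`. Positivity, primitivity and the
residues modulo `8` that define the two types are stable under the moves (`Good`), so that all
configurations enjoy them, and it suffices to show that `χ₂` is stable as well.

At one circle, of curvature `a`, the composition formula `qForm_mul` shows that the product of two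
represented integers of the same class (`Q_α` or `Q_β`) has the form `t² + 4 a² k²`, and that for
different classes twice the product has this form. Therefore the Kronecker symbol of a represented
integer modulo `a` only depends on its class, and changes by `(2/a)` with the class; the parity of
the integer, which is determined by the class, makes up for this (`Good.chiTwoExpr_eq`). The moves
`swap`, `mirror` and `flip` do not change the set of represented integers at all.

There remains `star`, the passage to a neighbour. If the curvatures `a` and `a'` of the two circles
are coprime, then `a + a'` is represented and admissible at both, and quadratic reciprocity gives the
claim. In general, inversion in the two dual circles at the edge produces infinitely many squares of
the grid containing it (`fan`); the Chinese remainder theorem provides one in which enough of the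
other three sides have coprime curvatures (`Good.sameVal_star_of_fan`, `Good.sameVal_star`). Lines
have to be treated apart, with the parametrization of Pythagorean triples.

At a circle whose curvature is a square the Kronecker symbol is `1`, so that `χ₂ = -1` excludes
squares. To refute the Local-Global Conjecture, arbitrarily large squares must satisfy all congruence
conditions. Completing squares turns `curvature = n²` into `X² + Y² = e (e + 4 n²)`, which is soluble
modulo the powers of an odd prime that does not divide the right-hand side. One inversion, chosen
by the Chinese remainder theorem, makes the right-hand side prime to all odd primes dividing a given
modulus; at `2` the equation has a simple root to be lifted (`Good.exists_dvd`).
-/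

/-! ### Curvatures of a square grid configuration -/

/-- The curvatures of a square grid configuration, seen from one of its circles: the circle at
distance `(i, j)` in the grid has curvature `a + b i + c j + e (i² - i + j² - j)`. -/
@[ext]
structure GridData where
  a : ℤ
  b : ℤ
  c : ℤ
  e : ℤ

namespace GridData

/-- Reflection of the grid in the diagonal. -/
def swap (δ : GridData) : GridData := ⟨δ.a, δ.c, δ.b, δ.e⟩

/-- Reflection of the grid in the vertical line through the central circle. -/
def mirror (δ : GridData) : GridData := ⟨δ.a, 2 * δ.e - δ.b, δ.c, δ.e⟩

/-- Passage to the right neighbour, followed by the reflection of the grid in the vertical line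
through this neighbour: an involution that exchanges the two ends of a horizontal edge. -/
def star (δ : GridData) : GridData := ⟨δ.a + δ.b, -δ.b, δ.c, δ.e⟩

/-- The effect of the inversion in the dual circle to the top right of the central circle. -/
def flip (δ : GridData) : GridData := ⟨δ.a, δ.b, δ.c, 4 * δ.a + 2 * δ.b + 2 * δ.c - δ.e⟩

/-- The same configuration, seen from the circle in position `(i, j)`. -/
def shift (δ : GridData) (i j : ℤ) : GridData :=
  ⟨δ.a + δ.b * i + δ.c * j + δ.e * (i ^ 2 - i + j ^ 2 - j), δ.b + 2 * δ.e * i,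
    δ.c + 2 * δ.e * j, δ.e⟩

/-- Twice the curvature of the dual circle of the face whose lower left corner is `(f, g)`. -/
def dualCurv (δ : GridData) (f g : ℤ) : ℤ :=
  2 * δ.a + δ.b * (2 * f + 1) + δ.c * (2 * g + 1) + 2 * δ.e * (f ^ 2 + g ^ 2) - δ.e

/-- The configuration after the inversion in the dual circle of the face whose lower left corner is
`(f, g)`, seen from the image of the central circle. -/
def reflectAt (δ : GridData) (f g : ℤ) : GridData :=
  ⟨δ.a + 2 * (f ^ 2 + f + g ^ 2 + g) * δ.dualCurv f g, δ.b - 4 * f * δ.dualCurv f g,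
    δ.c - 4 * g * δ.dualCurv f g, δ.e + 2 * δ.dualCurv f g⟩

theorem shift_reflectAt (δ : GridData) (f g : ℤ) :
    (δ.reflectAt f g).shift f g = (δ.shift f g).flip := by
  ext <;> simp only [shift, reflectAt, flip, dualCurv] <;> ring

theorem star_star (δ : GridData) : δ.star.star = δ := by
  ext <;> simp only [star] <;> ring

theorem shift_zero (δ : GridData) : δ.shift 0 0 = δ := by
  ext <;> simp only [shift] <;> ring

theorem shift_shift (δ : GridData) (i j k l : ℤ) :
    (δ.shift i j).shift k l = δ.shift (i + k) (j + l) := by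
  ext <;> simp only [shift] <;> ring

/-- A property that is stable under the symmetries of the grid does not depend on the circle from
which a configuration is seen. -/
theorem shift_of_invariant {Pr : GridData → Prop} (hswap : ∀ δ, Pr δ → Pr δ.swap)
    (hmirror : ∀ δ, Pr δ → Pr δ.mirror) (hstar : ∀ δ, Pr δ → Pr δ.star) (δ : GridData)
    (h : Pr δ) (i j : ℤ) : Pr (δ.shift i j) := by
  have right : ∀ δ : GridData, Pr δ → Pr (δ.shift 1 0) := by
    intro δ h
    have := hmirror _ (hstar _ h)
    convert this using 1
    ext <;> simp only [shift, star, mirror] <;> ring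
  have left : ∀ δ : GridData, Pr δ → Pr (δ.shift (-1) 0) := by
    intro δ h
    have := hstar _ (hmirror _ h)
    have := hmirror _ (hmirror _ this)
    convert this using 1
    ext <;> simp only [shift, star, mirror] <;> ring
  have horiz : ∀ δ : GridData, Pr δ → ∀ i : ℤ, Pr (δ.shift i 0) := by
    intro δ h i
    induction i using Int.induction_on with
    | zero => rwa [shift_zero]
    | succ i ih => simpa [shift_shift] using right _ ih
    | pred i ih => simpa [shift_shift, sub_eq_add_neg] using left _ ih
  have := hswap _ (horiz _ (hswap _ (horiz _ h i)) j)
  convert this using 1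
  ext <;> simp only [shift, swap] <;> ring

/-- A property that is stable under the symmetries of the grid and under the inversion in one dual
circle is stable under the inversions in all dual circles. -/
theorem reflectAt_of_invariant {Pr : GridData → Prop} (hswap : ∀ δ, Pr δ → Pr δ.swap)
    (hmirror : ∀ δ, Pr δ → Pr δ.mirror) (hstar : ∀ δ, Pr δ → Pr δ.star)
    (hflip : ∀ δ, Pr δ → Pr δ.flip) (δ : GridData) (h : Pr δ) (f g : ℤ) :
    Pr (δ.reflectAt f g) := by
  have h1 := hflip _ (shift_of_invariant hswap hmirror hstar δ h f g)
  rw [← shift_reflectAt] at h1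
  simpa [shift_shift, shift_zero] using shift_of_invariant hswap hmirror hstar _ h1 (-f) (-g)

/-- An integer divides all curvatures of the configuration. -/
def Dvd (d : ℤ) (δ : GridData) : Prop := d ∣ δ.a ∧ d ∣ δ.b ∧ d ∣ δ.c ∧ d ∣ δ.e

theorem Dvd.swap {d : ℤ} {δ : GridData} (h : Dvd d δ) : Dvd d δ.swap :=
  ⟨h.1, h.2.2.1, h.2.1, h.2.2.2⟩

theorem Dvd.mirror {d : ℤ} {δ : GridData} (h : Dvd d δ) : Dvd d δ.mirror :=
  ⟨h.1, (h.2.2.2.mul_left 2).sub h.2.1, h.2.2.1, h.2.2.2⟩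

theorem Dvd.star {d : ℤ} {δ : GridData} (h : Dvd d δ) : Dvd d δ.star :=
  ⟨h.1.add h.2.1, h.2.1.neg_right, h.2.2.1, h.2.2.2⟩

theorem Dvd.flip {d : ℤ} {δ : GridData} (h : Dvd d δ) : Dvd d δ.flip :=
  ⟨h.1, h.2.1, h.2.2.1, (((h.1.mul_left 4).add (h.2.1.mul_left 2)).add
    (h.2.2.1.mul_left 2)).sub h.2.2.2⟩

/-- The residues of type `(1)`. -/
def IsOne (δ : GridData) : Prop := δ.a % 8 = 1 ∧ δ.b % 8 = 0 ∧ δ.c % 8 = 0 ∧ δ.e % 4 = 0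

/-- The residues of full type. -/
def IsFull (δ : GridData) : Prop := δ.e % 4 = 1 ∧ (δ.b + δ.c) % 2 = 1

/-- The data of a configuration in a primitive integral packing of type `(1)` or of full type. The
equation says that the curvature is a null functional on inversive coordinates. -/
structure Good (δ : GridData) : Prop where
  null : δ.b ^ 2 + δ.c ^ 2 + δ.e ^ 2 = 2 * δ.e * (δ.b + δ.c) + 4 * δ.e * δ.a
  pos : 0 < 2 * δ.a + δ.e
  prim : ∀ d, Dvd d δ → IsUnit d
  type : IsOne δ ∨ IsFull δ

theorem swap_swap (δ : GridData) : δ.swap.swap = δ := rfl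

theorem mirror_mirror (δ : GridData) : δ.mirror.mirror = δ := by
  ext <;> simp only [mirror] <;> ring

theorem flip_flip (δ : GridData) : δ.flip.flip = δ := by
  ext <;> simp only [flip] <;> ring

theorem star_flip (δ : GridData) : δ.flip.star = δ.star.flip := by
  ext <;> simp only [star, flip] <;> ring

theorem Good.swap {δ : GridData} (h : Good δ) : Good δ.swap where
  null := by have := h.null; simp only [GridData.swap]; linarith
  pos := h.pos
  prim d hd := h.prim d hd.swap
  type := by
    have := h.type
    simp only [IsOne, IsFull, GridData.swap] at this ⊢
    omega

theorem Good.mirror {δ : GridData} (h : Good δ) : Good δ.mirror where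
  null := by have := h.null; simp only [GridData.mirror]; linear_combination this
  pos := h.pos
  prim d hd := h.prim d (by simpa [mirror_mirror] using hd.mirror)
  type := by
    have := h.type
    simp only [IsOne, IsFull, GridData.mirror] at this ⊢
    omega

/-- Nullity in terms of the coefficients of `Q_β (x, y) = P (x² + y²) + R (y² - x²) + 2 S x y`, where
`P = 2 a + e`, `R = b - e` and `S = c - e`: this form has discriminant `-16 a²`. -/
theorem Good.disc {δ : GridData} (h : Good δ) :
    (2 * δ.a + δ.e) ^ 2 = (δ.b - δ.e) ^ 2 + (δ.c - δ.e) ^ 2 + 4 * δ.a ^ 2 := by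
  linear_combination -h.null

theorem Good.star {δ : GridData} (h : Good δ) : Good δ.star where
  null := by have := h.null; simp only [GridData.star]; linear_combination this
  pos := by
    have h1 := h.disc
    have h2 := h.pos
    simp only [GridData.star]
    -- the new value is `3 P + 2 R - 4 a` with `R² + (2 a)² ≤ P²`
    by_contra hn
    push Not at hn
    have h3 : 3 * (2 * δ.a + δ.e) ≤ 2 * (2 * δ.a) - 2 * (δ.b - δ.e) := by linarith
    have h4 : (3 * (2 * δ.a + δ.e)) ^ 2 ≤ (2 * (2 * δ.a) - 2 * (δ.b - δ.e)) ^ 2 :=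
      pow_le_pow_left₀ (by linarith) h3 2
    nlinarith [sq_nonneg (2 * δ.a + (δ.b - δ.e)), sq_nonneg (δ.c - δ.e), pow_pos h2 2]
  prim d hd := h.prim d (by simpa [star_star] using hd.star)
  type := by
    have := h.type
    simp only [IsOne, IsFull, GridData.star] at this ⊢
    omega

theorem Good.flip {δ : GridData} (h : Good δ) : Good δ.flip where
  null := by have := h.null; simp only [GridData.flip]; linear_combination this
  pos := by
    have h1 := h.disc
    have h2 := h.pos
    simp only [GridData.flip]
    by_contra hn
    push Not at hn
    -- the new value is `3 P + 2 R + 2 S` with `R² + S² ≤ P²`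
    have h3 : 3 * (2 * δ.a + δ.e) ≤ - 2 * (δ.c - δ.e) - 2 * (δ.b - δ.e) := by linarith
    have h4 : (3 * (2 * δ.a + δ.e)) ^ 2 ≤ (- 2 * (δ.c - δ.e) - 2 * (δ.b - δ.e)) ^ 2 :=
      pow_le_pow_left₀ (by linarith) h3 2
    nlinarith [sq_nonneg ((δ.c - δ.e) - (δ.b - δ.e)), sq_nonneg (δ.a), pow_pos h2 2]
  prim d hd := h.prim d (by simpa [flip_flip] using hd.flip)
  type := by
    have := h.type
    simp only [IsOne, IsFull, GridData.flip] at this ⊢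
    omega

/-! ### The represented integers -/

/-- The form `Q_β` of the central circle; `Q_α` is half of it. -/
def qForm (δ : GridData) (x y : ℤ) : ℤ :=
  (2 * δ.a - δ.b + 2 * δ.e) * x ^ 2 + 2 * (δ.c - δ.e) * x * y + (2 * δ.a + δ.b) * y ^ 2

/-- `ρ` is represented at the central circle, by `Q_α` or `Q_β` according to the parity of `x y`. -/
def Rep (δ : GridData) (ρ : ℤ) : Prop :=
  ∃ x y : ℤ, IsCoprime x y ∧
    (Odd (x * y) ∧ 2 * ρ = δ.qForm x y ∨ Even (x * y) ∧ ρ = δ.qForm x y)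

theorem Rep.mirror {δ : GridData} {ρ : ℤ} (h : Rep δ ρ) : Rep δ.mirror ρ := by
  obtain ⟨x, y, hxy, h⟩ := h
  have : δ.mirror.qForm y x = δ.qForm x y := by
    simp only [qForm, GridData.mirror]; ring
  refine ⟨y, x, hxy.symm, ?_⟩
  rwa [this, mul_comm]

theorem Rep.flip {δ : GridData} {ρ : ℤ} (h : Rep δ ρ) : Rep δ.flip ρ := by
  obtain ⟨x, y, hxy, h⟩ := h
  have : δ.flip.qForm (-x) (y - 2 * x) = δ.qForm x y := by
    simp only [qForm, GridData.flip]; ring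
  refine ⟨-x, y - 2 * x, ?_, ?_⟩
  · obtain ⟨u, v, huv⟩ := hxy
    exact ⟨-u - 2 * v, v, by linear_combination huv⟩
  · have h2 : -x * (y - 2 * x) = x * y + 2 * (x * x - x * y) := by ring
    rw [this, h2]
    simpa [Int.odd_add, Int.even_add] using h

theorem Rep.swap {δ : GridData} {ρ : ℤ} (h : Rep δ ρ) : Rep δ.swap ρ := by
  obtain ⟨x, y, ⟨u, v, huv⟩, ⟨h1, h2⟩ | ⟨h1, h2⟩⟩ := h
  · obtain ⟨⟨r, rfl⟩, ⟨s, rfl⟩⟩ := Int.odd_mul.1 h1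
    refine ⟨s - r, r + s + 1, ?_, Or.inr ⟨?_, ?_⟩⟩
    · exact ⟨v - u, u + v, by linear_combination huv⟩
    · rw [Int.even_mul]
      by_cases h : Even (s - r)
      · exact Or.inl h
      · right
        have : r + s + 1 = (s - r) + (2 * r + 1) := by ring
        rw [this, Int.even_add]
        simp [h]
    · simp only [qForm, GridData.swap] at h2 ⊢
      apply mul_left_cancel₀ (two_ne_zero (α := ℤ))
      rw [h2]; ring
  · have key : 2 * ρ = δ.swap.qForm (y - x) (x + y) := by
      rw [h2]; simp only [qForm, GridData.swap]; ring
    have hodd : Odd (x + y) := by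
      rw [Int.even_mul] at h1
      by_contra hn
      rw [Int.not_odd_iff_even, Int.even_add] at hn
      obtain ⟨⟨r, hr⟩, s, hs⟩ : Even x ∧ Even y := by tauto
      have : 2 * (u * r + v * s) = 1 := by rw [← huv, hr, hs]; ring
      omega
    have hodd' : Odd (y - x) := by
      have : y - x = (x + y) - 2 * x := by ring
      rw [this, Int.odd_sub]; simp [hodd]
    refine ⟨y - x, x + y, ?_, Or.inl ⟨hodd'.mul hodd, key⟩⟩
    have h2u : IsCoprime (y - x) 2 := by
      obtain ⟨k, hk⟩ := hodd'
      exact ⟨1, -k, by linear_combination hk⟩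
    have h3 : IsCoprime (y - x) (2 * x) := by
      refine h2u.mul_right ?_
      exact ⟨v, u + v, by linear_combination huv⟩
    have := h3.add_mul_left_right 1
    rwa [show 2 * x + (y - x) * 1 = x + y by ring] at this

end GridData

/-! ### Kronecker symbols -/

theorem Int.exists_eq_two_pow_mul_odd {a : ℤ} (ha : a ≠ 0) :
    ∃ (v : ℕ) (u : ℤ), Odd u ∧ a = 2 ^ v * u := by
  obtain ⟨v, u, hu, h⟩ := Nat.exists_eq_two_pow_mul_odd (Int.natAbs_ne_zero.2 ha)
  rcases Int.natAbs_eq a with h' | h'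
  · exact ⟨v, u, by exact_mod_cast hu, by rw [h', h]; push_cast; ring⟩
  · exact ⟨v, -u, (by exact_mod_cast hu : Odd (u : ℤ)).neg, by rw [h', h]; push_cast; ring⟩

theorem kroneckerSymbol_two_pow_mul {ρ u : ℤ} (v : ℕ) (hu : Odd u) (hρ : 0 < ρ) :
    kroneckerSymbol ρ (2 ^ v * u) = ZMod.χ₈ (ρ : ZMod 8) ^ v * jacobiSym ρ u.natAbs := by
  have hu0 : u ≠ 0 := by rintro rfl; simp at hu
  have hna : Odd u.natAbs := Int.natAbs_odd.2 hu
  have h0 : (2 : ℤ) ^ v * u ≠ 0 := mul_ne_zero (by positivity) hu0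
  have habs : ((2 : ℤ) ^ v * u).natAbs = 2 ^ v * u.natAbs := by
    rw [Int.natAbs_mul, Int.natAbs_pow]; rfl
  have hv : padicValNat 2 (2 ^ v * u.natAbs) = v := by
    rw [padicValNat.mul (by positivity) (Int.natAbs_ne_zero.2 hu0), padicValNat.prime_pow,
      padicValNat.eq_zero_of_not_dvd, add_zero]
    rintro ⟨k, hk⟩
    obtain ⟨l, hl⟩ := hna
    omega
  rw [kroneckerSymbol, if_neg h0, if_neg (by omega), habs, hv,
    Nat.mul_div_cancel_left _ (by positivity), one_mul]

theorem kroneckerSymbol_odd {ρ u : ℤ} (hu : Odd u) (hρ : 0 < ρ) :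
    kroneckerSymbol ρ u = jacobiSym ρ u.natAbs := by
  simpa using kroneckerSymbol_two_pow_mul 0 hu hρ

theorem chi8_of_odd {n : ℤ} (hn : Odd n) :
    ZMod.χ₈ (n : ZMod 8) = if n % 8 = 1 ∨ n % 8 = 7 then 1 else -1 := by
  rw [ZMod.χ₈_int_eq_if_mod_eight, if_neg (by rw [Int.odd_iff] at hn; omega)]

theorem isCoprime_natAbs_gcd {x y : ℤ} (h : IsCoprime x y) : Int.gcd x y.natAbs = 1 := by
  rw [Int.isCoprime_iff_gcd_eq_one] at h
  rwa [Int.gcd, Int.natAbs_natCast]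

theorem kroneckerSymbol_eq_one_or_neg_one {ρ a : ℤ} (ha : a ≠ 0) (hρ : 0 < ρ)
    (h : IsCoprime ρ a) : kroneckerSymbol ρ a = 1 ∨ kroneckerSymbol ρ a = -1 := by
  obtain ⟨v, u, hu, rfl⟩ := Int.exists_eq_two_pow_mul_odd ha
  rw [kroneckerSymbol_two_pow_mul v hu hρ]
  have h1 := jacobiSym.eq_one_or_neg_one (isCoprime_natAbs_gcd h.of_mul_right_right)
  have h2 : ZMod.χ₈ (ρ : ZMod 8) ^ v = 1 ∨ ZMod.χ₈ (ρ : ZMod 8) ^ v = -1 := by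
    rcases Nat.eq_zero_or_pos v with rfl | hv
    · simp
    · have h3 : IsCoprime ρ 2 := (IsCoprime.pow_right_iff hv).1 h.of_mul_right_left
      have : Odd ρ := by
        rcases Int.even_or_odd ρ with ⟨k, hk⟩ | h
        · obtain ⟨s, t, hst⟩ := h3
          rw [hk] at hst
          have : 2 * (s * k + t) = 1 := by linear_combination hst
          omega
        · exact h
      rw [chi8_of_odd this]
      split_ifs
      · simp
      · exact neg_one_pow_eq_or ℤ v
  rcases h1 with h1 | h1 <;> rcases h2 with h2 | h2 <;> rw [h1, h2] <;> simp

theorem kroneckerSymbol_mul_left {ρ σ a : ℤ} (ha : a ≠ 0) (hρ : 0 < ρ) (hσ : 0 < σ) :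
    kroneckerSymbol (ρ * σ) a = kroneckerSymbol ρ a * kroneckerSymbol σ a := by
  obtain ⟨v, u, hu, rfl⟩ := Int.exists_eq_two_pow_mul_odd ha
  rw [kroneckerSymbol_two_pow_mul v hu hρ, kroneckerSymbol_two_pow_mul v hu hσ,
    kroneckerSymbol_two_pow_mul v hu (mul_pos hρ hσ), jacobiSym.mul_left]
  push_cast
  rw [map_mul]
  ring

theorem jacobiSym_eq_of_dvd_sub {x y u : ℤ} (h : u ∣ x - y) :
    jacobiSym x u.natAbs = jacobiSym y u.natAbs := by
  apply jacobiSym.mod_left'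
  have : (u.natAbs : ℤ) ∣ x - y := Int.natAbs_dvd.2 h
  exact ((Int.modEq_iff_dvd).2 this).symm

theorem jacobiSym_sq_add_mul {t k u : ℤ} (h : IsCoprime (t ^ 2 + u * k) u) :
    jacobiSym (t ^ 2 + u * k) u.natAbs = 1 := by
  rw [jacobiSym_eq_of_dvd_sub (y := t ^ 2) (by simp)]
  apply jacobiSym.sq_one'
  apply isCoprime_natAbs_gcd
  have h2 : IsCoprime (t ^ 2) u := by
    simpa using h
  exact (IsCoprime.pow_left_iff (by norm_num)).1 h2

/-- A product of two represented integers of the same class is a square modulo `4 a²`. -/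
theorem kroneckerSymbol_sq_add {t k a n : ℤ} (ha : a ≠ 0) (hn : 0 < n)
    (h : n = t ^ 2 + 4 * a ^ 2 * k ^ 2) (hc : IsCoprime n a) : kroneckerSymbol n a = 1 := by
  obtain ⟨v, u, hu, rfl⟩ := Int.exists_eq_two_pow_mul_odd ha
  rw [kroneckerSymbol_two_pow_mul v hu hn]
  have h1 : jacobiSym n u.natAbs = 1 := by
    have h2 : n = t ^ 2 + u * (4 * (2 ^ v) ^ 2 * u * k ^ 2) := by rw [h]; ring
    have hc' := hc.of_mul_right_right
    rw [h2] at hc' ⊢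
    exact jacobiSym_sq_add_mul hc'
  rw [h1, mul_one]
  rcases v with _ | v
  · simp
  · have h3 : IsCoprime n 2 := (IsCoprime.pow_right_iff (Nat.succ_pos v)).1 hc.of_mul_right_left
    have h4 : n = t ^ 2 + 8 * (2 * (2 ^ v) ^ 2 * u ^ 2 * k ^ 2) := by rw [h]; ring
    have hodd : Odd t := by
      rcases Int.even_or_odd t with ⟨r, hr⟩ | h
      · exfalso
        obtain ⟨x, y, hxy⟩ := h3
        rw [h4, hr] at hxy
        have : 2 * (x * (2 * r ^ 2 + 4 * (2 * (2 ^ v) ^ 2 * u ^ 2 * k ^ 2)) + y) = 1 := by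
          linear_combination hxy
        omega
      · exact h
    have h5 : n % 8 = 1 := by
      have := Int.eight_dvd_sq_sub_one_of_odd hodd
      omega
    have h6 : Odd n := by rw [Int.odd_iff]; omega
    rw [chi8_of_odd h6, if_pos (Or.inl h5), one_pow]

theorem kroneckerSymbol_sq_right {ρ a : ℤ} (ha : a ≠ 0) (hρ : 0 < ρ) (h : IsCoprime ρ a) :
    kroneckerSymbol ρ (a ^ 2) = 1 := by
  obtain ⟨v, u, hu, rfl⟩ := Int.exists_eq_two_pow_mul_odd ha
  have h1 := kroneckerSymbol_eq_one_or_neg_one ha hρ h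
  rw [mul_pow, ← pow_mul, kroneckerSymbol_two_pow_mul (v * 2) (hu.pow) hρ, Int.natAbs_pow,
    jacobiSym.pow_right, pow_mul, ← mul_pow, ← kroneckerSymbol_two_pow_mul v hu hρ]
  rcases h1 with h1 | h1 <;> rw [h1] <;> norm_num

theorem chi8_natAbs (u : ℤ) : ZMod.χ₈ (u.natAbs : ZMod 8) = ZMod.χ₈ (u : ZMod 8) := by
  rcases Int.natAbs_eq u with h | h
  · conv_rhs => rw [h, Int.cast_natCast]
  · conv_rhs => rw [h, ← neg_one_mul (u.natAbs : ℤ), Int.cast_mul, map_mul]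
    have : ZMod.χ₈ (((-1 : ℤ)) : ZMod 8) = 1 := by decide
    rw [this, one_mul, Int.cast_natCast]

theorem jacobiSym_two {u : ℤ} (hu : Odd u) : jacobiSym 2 u.natAbs = ZMod.χ₈ (u : ZMod 8) := by
  rw [jacobiSym.at_two (Int.natAbs_odd.2 hu), chi8_natAbs]

theorem jacobiSym_of_neg {x : ℤ} {n : ℕ} (hn : Odd n) (hx : x < 0) :
    jacobiSym x n = (if n % 4 = 1 then 1 else -1) * jacobiSym x.natAbs n := by
  have h : x = (-1) * (x.natAbs : ℤ) := by omega
  conv_lhs => rw [h]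
  rw [jacobiSym.mul_left, jacobiSym.at_neg_one hn, ZMod.χ₄_nat_eq_if_mod_four]
  rw [Nat.odd_iff] at hn
  rw [if_neg (by omega)]

/-- Quadratic reciprocity for odd integers that are not both negative. -/
theorem jacobiSym_reciprocity {x y : ℤ} (hx : Odd x) (hy : Odd y) (h : 0 < x ∨ 0 < y) :
    jacobiSym x y.natAbs = (if x % 4 = 3 ∧ y % 4 = 3 then -1 else 1) * jacobiSym y x.natAbs := by
  have key : ∀ x y : ℤ, Odd x → Odd y → 0 < y →
      jacobiSym x y.natAbs =
        (if x % 4 = 3 ∧ y % 4 = 3 then -1 else 1) * jacobiSym y x.natAbs := by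
    intro x y hx hy hy0
    have hx' := Int.natAbs_odd.2 hx
    have hy' := Int.natAbs_odd.2 hy
    have hyy : (y.natAbs : ℤ) = y := by omega
    have hrec := jacobiSym.quadratic_reciprocity_if (Nat.odd_iff.1 hx') (Nat.odd_iff.1 hy')
    rw [hyy] at hrec
    rw [Int.odd_iff] at hx hy
    rcases lt_or_gt_of_ne (show x ≠ 0 by omega) with hx0 | hx0
    · rw [jacobiSym_of_neg hy' hx0, ← hrec]
      split_ifs <;> omega
    · have hxx : (x.natAbs : ℤ) = x := by omega
      rw [hxx] at hrec
      rw [← hrec]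
      split_ifs <;> omega
  rcases h with h | h
  · rw [key y x hy hx h]
    split_ifs <;> omega
  · exact key x y hx hy h

/-! ### The invariant at one circle -/

/-- The factor by which `χ₂` differs from the Kronecker symbol. -/
def chiSign (a ρ : ℤ) : ℤ :=
  if a % 8 = 3 then (if ρ % 2 = 0 then 1 else -1)
  else if a % 8 = 5 then (if ρ % 2 = 0 then -1 else 1)
  else if a % 8 = 2 ∨ a % 8 = 6 ∨ a % 8 = 7 then -1 else 1

theorem chiTwoExpr_eq (a ρ : ℤ) :
    SquarePacking.chiTwoExpr a ρ = chiSign a ρ * kroneckerSymbol ρ a := by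
  have h1 : ((ρ + 1).negOnePow : ℤ) = -(ρ.negOnePow : ℤ) := by
    rw [Int.negOnePow_succ]; rfl
  have h2 : (ρ.negOnePow : ℤ) = if ρ % 2 = 0 then 1 else -1 := by
    split_ifs with h
    · rw [Int.negOnePow_even _ (Int.even_iff.2 h)]; rfl
    · rw [Int.negOnePow_odd _ (Int.odd_iff.2 (by omega))]; rfl
  rw [SquarePacking.chiTwoExpr, chiSign, h1, h2]
  split_ifs <;> simp

theorem chiSign_eq_one_or_neg_one (a ρ : ℤ) : chiSign a ρ = 1 ∨ chiSign a ρ = -1 := by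
  rw [chiSign]; split_ifs <;> simp

namespace GridData

/-- Composition of forms of discriminant `-16 a²`. -/
theorem Good.qForm_mul {δ : GridData} (h : Good δ) (x y z w : ℤ) :
    δ.qForm x y * δ.qForm z w = ((2 * δ.a - δ.b + 2 * δ.e) * (x * z) +
      (δ.c - δ.e) * (x * w + y * z) + (2 * δ.a + δ.b) * (y * w)) ^ 2 +
      4 * δ.a ^ 2 * (x * w - y * z) ^ 2 := by
  simp only [qForm]
  linear_combination (- (x * w - y * z) ^ 2) * h.null

theorem Good.qForm_nonneg {δ : GridData} (h : Good δ) (x y : ℤ) : 0 ≤ δ.qForm x y := by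
  have h1 := h.disc
  have h2 := h.pos
  have h3 : δ.qForm x y = (2 * δ.a + δ.e) * (x ^ 2 + y ^ 2) +
    ((δ.b - δ.e) * (y ^ 2 - x ^ 2) + (δ.c - δ.e) * (2 * x * y)) := by
    simp only [qForm]; ring
  have h4 : ((δ.b - δ.e) * (y ^ 2 - x ^ 2) + (δ.c - δ.e) * (2 * x * y)) ^ 2 ≤
      ((2 * δ.a + δ.e) * (x ^ 2 + y ^ 2)) ^ 2 := by
    have h5 : ((2 * δ.a + δ.e) * (x ^ 2 + y ^ 2)) ^ 2 -
      ((δ.b - δ.e) * (y ^ 2 - x ^ 2) + (δ.c - δ.e) * (2 * x * y)) ^ 2 =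
      ((δ.b - δ.e) * (2 * x * y) - (δ.c - δ.e) * (y ^ 2 - x ^ 2)) ^ 2 +
        (2 * δ.a * (x ^ 2 + y ^ 2)) ^ 2 := by
      linear_combination (x ^ 2 + y ^ 2) ^ 2 * h1
    nlinarith [sq_nonneg ((δ.b - δ.e) * (2 * x * y) - (δ.c - δ.e) * (y ^ 2 - x ^ 2)),
      sq_nonneg (2 * δ.a * (x ^ 2 + y ^ 2))]
  have h6 := abs_le_of_sq_le_sq h4 (by positivity)
  rw [h3]
  linarith [(abs_le.1 h6).1]

theorem Good.rep_nonneg {δ : GridData} (h : Good δ) {ρ : ℤ} (hr : Rep δ ρ) : 0 ≤ ρ := by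
  obtain ⟨x, y, -, ⟨-, h1⟩ | ⟨-, h1⟩⟩ := hr <;> have := h.qForm_nonneg x y <;> omega

theorem Good.rep_pos {δ : GridData} (h : Good δ) {ρ : ℤ} (hr : Rep δ ρ)
    (hc : IsCoprime ρ δ.a) : 0 < ρ := by
  refine lt_of_le_of_ne (h.rep_nonneg hr) ?_
  rintro rfl
  have ha : δ.a ≠ 0 := by
    intro h0
    rw [h0] at hc
    exact not_isCoprime_zero_zero hc
  obtain ⟨x, y, hxy, h1⟩ := hr
  have hq : δ.qForm x y = 0 := by rcases h1 with h1 | h1 <;> omega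
  -- the form is definite, since its discriminant is not zero
  have e1 := h.qForm_mul x y 1 0
  have e2 := h.qForm_mul x y 0 1
  rw [hq] at e1 e2
  have hy : y = 0 := by
    by_contra hy
    have : 0 < 4 * δ.a ^ 2 * (x * 0 - y * 1) ^ 2 := by
      have : x * 0 - y * 1 ≠ 0 := by simpa using hy
      positivity
    nlinarith [sq_nonneg ((2 * δ.a - δ.b + 2 * δ.e) * (x * 1) +
      (δ.c - δ.e) * (x * 0 + y * 1) + (2 * δ.a + δ.b) * (y * 0))]
  have hx : x = 0 := by
    by_contra hx
    have : 0 < 4 * δ.a ^ 2 * (x * 1 - y * 0) ^ 2 := by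
      have : x * 1 - y * 0 ≠ 0 := by simpa using hx
      positivity
    nlinarith [sq_nonneg ((2 * δ.a - δ.b + 2 * δ.e) * (x * 0) +
      (δ.c - δ.e) * (x * 1 + y * 0) + (2 * δ.a + δ.b) * (y * 1))]
  rw [hx, hy] at hxy
  exact not_isCoprime_zero_zero hxy

theorem qForm_emod_two_of_even {δ : GridData} {x y ρ : ℤ} (hxy : IsCoprime x y)
    (h : Even (x * y)) (hρ : ρ = δ.qForm x y) : ρ % 2 = δ.b % 2 := by
  have hodd : Odd (x ^ 2 + y ^ 2) := by
    obtain ⟨u, v, huv⟩ := hxy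
    rw [Int.even_mul] at h
    by_contra hn
    rw [Int.not_odd_iff_even, Int.even_add, Int.even_pow' two_ne_zero,
      Int.even_pow' two_ne_zero] at hn
    obtain ⟨⟨r, hr⟩, s, hs⟩ : Even x ∧ Even y := by tauto
    have : 2 * (u * r + v * s) = 1 := by rw [← huv, hr, hs]; ring
    omega
  obtain ⟨k, hk⟩ := hodd
  have : ρ = δ.b + 2 * (δ.b * k + (δ.a - δ.b + δ.e) * x ^ 2 + (δ.c - δ.e) * x * y +
      δ.a * y ^ 2) := by
    rw [hρ, qForm]; linear_combination δ.b * hk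
  omega

theorem qForm_emod_two_of_odd {δ : GridData} {x y ρ : ℤ}
    (h : Odd (x * y)) (hρ : 2 * ρ = δ.qForm x y) : ρ % 2 = δ.c % 2 := by
  obtain ⟨⟨r, rfl⟩, ⟨s, rfl⟩⟩ := Int.odd_mul.1 h
  have : ρ = δ.c + 2 * (δ.a + (2 * δ.a - δ.b + 2 * δ.e) * (r ^ 2 + r)
    + (δ.c - δ.e) * (2 * r * s + r + s) + (2 * δ.a + δ.b) * (s ^ 2 + s)) := by
    apply mul_left_cancel₀ (two_ne_zero (α := ℤ))
    rw [hρ, qForm]; ring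
  omega

theorem eq_of_mul_eq_one {s t : ℤ} (hs : s = 1 ∨ s = -1) (h : s * t = 1) : s = t := by
  rcases hs with rfl | rfl <;> linarith

/-- Two represented integers of the same class have the same Kronecker symbol. -/
theorem kroneckerSymbol_eq_of_mul {a ρ σ t k : ℤ} (ha : a ≠ 0) (hρ : 0 < ρ) (hσ : 0 < σ)
    (hρa : IsCoprime ρ a) (hσa : IsCoprime σ a) (h : ρ * σ = t ^ 2 + 4 * a ^ 2 * k ^ 2) :
    kroneckerSymbol ρ a = kroneckerSymbol σ a := by
  apply eq_of_mul_eq_one (kroneckerSymbol_eq_one_or_neg_one ha hρ hρa)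
  rw [← kroneckerSymbol_mul_left ha hρ hσ]
  exact kroneckerSymbol_sq_add ha (mul_pos hρ hσ) h (hρa.mul_left hσa)

/-- For represented integers of different classes, twice the product is a square modulo `4 a²`. The
class determines the parity, so that the Kronecker symbol `(2/a)` is offset by the sign in `χ₂`. -/
theorem chiTwoExpr_eq_of_two_mul {δ : GridData} (h : Good δ) {ρ σ t k : ℤ} (hρ : 0 < ρ)
    (hσ : 0 < σ) (hρa : IsCoprime ρ δ.a) (hσa : IsCoprime σ δ.a) (ha : δ.a ≠ 0)
    (hm : 2 * (ρ * σ) = t ^ 2 + 4 * δ.a ^ 2 * k ^ 2) (hb : ρ % 2 = δ.c % 2)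
    (hc : σ % 2 = δ.b % 2) :
    SquarePacking.chiTwoExpr δ.a ρ = SquarePacking.chiTwoExpr δ.a σ := by
  have hcop := hρa.mul_left hσa
  have hodd : Odd δ.a := by
    by_contra hn
    rw [Int.not_odd_iff_even] at hn
    obtain ⟨r, hr⟩ := hn
    have ht : Even (t ^ 2) := ⟨ρ * σ - 2 * δ.a ^ 2 * k ^ 2, by linear_combination -hm⟩
    obtain ⟨s, hs⟩ := (Int.even_pow' two_ne_zero).1 ht
    obtain ⟨u, v, huv⟩ := hcop
    have h1 : ρ * σ = 2 * (s ^ 2 + δ.a ^ 2 * k ^ 2) := by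
      apply mul_left_cancel₀ (two_ne_zero (α := ℤ))
      rw [hm, hs]; ring
    have : 2 * (u * (s ^ 2 + δ.a ^ 2 * k ^ 2) + v * r) = 1 := by
      rw [← huv, h1, hr]; ring
    omega
  have h2 : IsCoprime 2 δ.a := by
    obtain ⟨r, hr⟩ := hodd
    exact ⟨-r, 1, by rw [hr]; ring⟩
  have h3 := kroneckerSymbol_sq_add ha (by positivity) hm (h2.mul_left hcop)
  rw [kroneckerSymbol_mul_left ha two_pos (mul_pos hρ hσ), kroneckerSymbol_mul_left ha hρ hσ,
    kroneckerSymbol_odd hodd two_pos, jacobiSym_two hodd, chi8_of_odd hodd] at h3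
  have h4 := kroneckerSymbol_eq_one_or_neg_one ha hρ hρa
  have h5 := kroneckerSymbol_eq_one_or_neg_one ha hσ hσa
  have h6 := h.type
  simp only [IsOne, IsFull] at h6
  have h7 := Int.odd_iff.1 hodd
  rw [chiTwoExpr_eq, chiTwoExpr_eq, chiSign, chiSign]
  generalize kroneckerSymbol ρ δ.a = K at *
  generalize kroneckerSymbol σ δ.a = L at *
  rcases h4 with rfl | rfl <;> rcases h5 with rfl | rfl <;> split_ifs at h3 ⊢ <;> omega

/-- `χ₂` does not depend on the choice of the represented integer. -/
theorem Good.chiTwoExpr_eq {δ : GridData} (h : Good δ) {ρ σ : ℤ} (hρ : Rep δ ρ) (hσ : Rep δ σ)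
    (hρa : IsCoprime ρ δ.a) (hσa : IsCoprime σ δ.a) :
    SquarePacking.chiTwoExpr δ.a ρ = SquarePacking.chiTwoExpr δ.a σ := by
  have hρ0 := h.rep_pos hρ hρa
  have hσ0 := h.rep_pos hσ hσa
  by_cases ha : δ.a = 0
  · rw [ha, isCoprime_zero_right, Int.isUnit_iff] at hρa hσa
    have h1 : ρ = 1 := by omega
    have h2 : σ = 1 := by omega
    rw [h1, h2]
  obtain ⟨x, y, hxy, h1⟩ := hρ
  obtain ⟨z, w, hzw, h2⟩ := hσ
  have key := h.qForm_mul x y z w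
  rcases h1 with ⟨h1, h1'⟩ | ⟨h1, h1'⟩ <;> rcases h2 with ⟨h2, h2'⟩ | ⟨h2, h2'⟩
  · have hp1 := qForm_emod_two_of_odd h1 h1'
    have hp2 := qForm_emod_two_of_odd h2 h2'
    rw [← h1', ← h2'] at key
    obtain ⟨hx, hy⟩ := Int.odd_mul.1 h1
    obtain ⟨hz, hw⟩ := Int.odd_mul.1 h2
    -- both the square root and the determinant are even
    obtain ⟨k, hk⟩ := (hx.mul hw).sub_odd (hy.mul hz)
    set T := (2 * δ.a - δ.b + 2 * δ.e) * (x * z) +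
      (δ.c - δ.e) * (x * w + y * z) + (2 * δ.a + δ.b) * (y * w)
    have hT : Even (T ^ 2) := ⟨2 * (ρ * σ) - 2 * δ.a ^ 2 * (x * w - y * z) ^ 2, by
      linear_combination -key⟩
    obtain ⟨s, hs⟩ := (Int.even_pow' two_ne_zero).1 hT
    have hm : ρ * σ = s ^ 2 + 4 * δ.a ^ 2 * k ^ 2 := by
      apply mul_left_cancel₀ (four_ne_zero (α := ℤ))
      rw [hk, hs] at key
      linear_combination key
    rw [_root_.chiTwoExpr_eq, _root_.chiTwoExpr_eq,
      kroneckerSymbol_eq_of_mul ha hρ0 hσ0 hρa hσa hm, chiSign, chiSign, hp1, hp2]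
  · have hp1 := qForm_emod_two_of_odd h1 h1'
    have hp2 := qForm_emod_two_of_even hzw h2 h2'
    rw [← h1', ← h2', mul_assoc] at key
    exact chiTwoExpr_eq_of_two_mul h hρ0 hσ0 hρa hσa ha key hp1 hp2
  · have hp1 := qForm_emod_two_of_even hxy h1 h1'
    have hp2 := qForm_emod_two_of_odd h2 h2'
    rw [← h1', ← h2'] at key
    exact (chiTwoExpr_eq_of_two_mul h hσ0 hρ0 hσa hρa ha
      (by rw [← key]; ring) hp2 hp1).symm
  · have hp1 := qForm_emod_two_of_even hxy h1 h1'
    have hp2 := qForm_emod_two_of_even hzw h2 h2'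
    rw [← h1', ← h2'] at key
    rw [_root_.chiTwoExpr_eq, _root_.chiTwoExpr_eq,
      kroneckerSymbol_eq_of_mul ha hρ0 hσ0 hρa hσa key, chiSign, chiSign, hp1, hp2]

/-- `ε` is a value of `χ₂` at the central circle. -/
def HasVal (δ : GridData) (ε : ℤ) : Prop :=
  ∃ ρ, Rep δ ρ ∧ IsCoprime ρ δ.a ∧ ε = SquarePacking.chiTwoExpr δ.a ρ

theorem Good.hasVal_unique {δ : GridData} (h : Good δ) {ε ε' : ℤ} (h1 : HasVal δ ε)
    (h2 : HasVal δ ε') : ε = ε' := by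
  obtain ⟨ρ, hρ, hρa, rfl⟩ := h1
  obtain ⟨σ, hσ, hσa, rfl⟩ := h2
  exact h.chiTwoExpr_eq hρ hσ hρa hσa

theorem kroneckerSymbol_zero_right_one : kroneckerSymbol 1 0 = 1 := by simp [kroneckerSymbol]

theorem Good.hasVal_eq_one_or_neg_one {δ : GridData} (h : Good δ) {ε : ℤ} (h1 : HasVal δ ε) :
    ε = 1 ∨ ε = -1 := by
  obtain ⟨ρ, hρ, hρa, rfl⟩ := h1
  have hρ0 := h.rep_pos hρ hρa
  rw [_root_.chiTwoExpr_eq]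
  have h2 := chiSign_eq_one_or_neg_one δ.a ρ
  have h3 : kroneckerSymbol ρ δ.a = 1 ∨ kroneckerSymbol ρ δ.a = -1 := by
    by_cases ha : δ.a = 0
    · rw [ha, isCoprime_zero_right, Int.isUnit_iff] at hρa
      rw [ha, show ρ = 1 by omega, kroneckerSymbol_zero_right_one]
      simp
    · exact kroneckerSymbol_eq_one_or_neg_one ha hρ0 hρa
  rcases h2 with h2 | h2 <;> rcases h3 with h3 | h3 <;> rw [h2, h3] <;> simp

theorem HasVal.swap {δ : GridData} {ε : ℤ} (h : HasVal δ ε) : HasVal δ.swap ε := by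
  obtain ⟨ρ, hρ, h⟩ := h
  exact ⟨ρ, hρ.swap, h⟩

theorem HasVal.mirror {δ : GridData} {ε : ℤ} (h : HasVal δ ε) : HasVal δ.mirror ε := by
  obtain ⟨ρ, hρ, h⟩ := h
  exact ⟨ρ, hρ.mirror, h⟩

theorem HasVal.flip {δ : GridData} {ε : ℤ} (h : HasVal δ ε) : HasVal δ.flip ε := by
  obtain ⟨ρ, hρ, h⟩ := h
  exact ⟨ρ, hρ.flip, h⟩

end GridData

/-! ### Reciprocity along edges with coprime curvatures -/

theorem isCoprime_add_self_left {x y : ℤ} (h : IsCoprime x y) : IsCoprime (x + y) x := by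
  simpa [add_comm] using h.symm.add_mul_left_left 1

theorem isCoprime_add_self_right {x y : ℤ} (h : IsCoprime x y) : IsCoprime (x + y) y := by
  simpa using h.add_mul_left_left 1

theorem chiTwoExpr_eq_of_odd_of_odd {x y : ℤ} (hx : Odd x) (hy : Odd y)
    (hpos : 0 < x + y)
    (hmod : x % 8 = 1 ∧ (y % 8 = 1 ∨ y % 8 = 3) ∨ x % 8 = 3 ∧ (y % 8 = 7 ∨ y % 8 = 1) ∨
      x % 8 = 5 ∧ (y % 8 = 5 ∨ y % 8 = 7) ∨ x % 8 = 7 ∧ (y % 8 = 3 ∨ y % 8 = 5)) :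
    SquarePacking.chiTwoExpr x (x + y) = SquarePacking.chiTwoExpr y (x + y) := by
  rw [chiTwoExpr_eq, chiTwoExpr_eq, kroneckerSymbol_odd hx hpos, kroneckerSymbol_odd hy hpos,
    jacobiSym_eq_of_dvd_sub (x := x + y) (y := y) (u := x) (by simp),
    jacobiSym_eq_of_dvd_sub (x := x + y) (y := x) (u := y) (by simp),
    jacobiSym_reciprocity hx hy (by omega), chiSign, chiSign]
  split_ifs <;> omega

theorem chiTwoExpr_eq_of_even_of_odd {x y : ℤ} (hx : Even x) (hy : Odd y) (hc : IsCoprime x y)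
    (hpos : 0 < x + y) (hmod : (y - x) % 4 = 1) :
    SquarePacking.chiTwoExpr x (x + y) = SquarePacking.chiTwoExpr y (x + y) := by
  by_cases hx0 : x = 0
  · have h1 : y = 1 := by
      rw [hx0, isCoprime_zero_left, Int.isUnit_iff] at hc
      omega
    rw [hx0, h1, chiTwoExpr_eq, chiTwoExpr_eq, kroneckerSymbol_odd odd_one (by norm_num)]
    simp [kroneckerSymbol, chiSign]
  obtain ⟨v, u, hu, hxu⟩ := Int.exists_eq_two_pow_mul_odd hx0
  have hp : (0 : ℤ) < 2 ^ v := by positivity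
  have hor : 0 < u ∨ 0 < y := by
    by_contra! hn
    nlinarith
  have hkx : kroneckerSymbol (x + y) x = ZMod.χ₈ ((x + y : ℤ) : ZMod 8) ^ v *
      ((if u % 4 = 3 ∧ y % 4 = 3 then -1 else 1) * jacobiSym u y.natAbs) := by
    conv_lhs => rw [hxu]
    rw [kroneckerSymbol_two_pow_mul v hu (hxu ▸ hpos), ← hxu,
      jacobiSym_eq_of_dvd_sub (x := x + y) (y := y) (u := u) (by simp [hxu]),
      jacobiSym_reciprocity hy hu hor.symm]
    simp only [and_comm]
  have hky : kroneckerSymbol (x + y) y = ZMod.χ₈ (y : ZMod 8) ^ v * jacobiSym u y.natAbs := by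
    rw [kroneckerSymbol_odd hy hpos,
      jacobiSym_eq_of_dvd_sub (x := x + y) (y := x) (u := y) (by simp), hxu, jacobiSym.mul_left,
      jacobiSym.pow_left, jacobiSym_two hy]
  rw [chiTwoExpr_eq, chiTwoExpr_eq, hkx, hky, chi8_of_odd (hx.add_odd hy), chi8_of_odd hy,
    chiSign, chiSign]
  generalize jacobiSym u y.natAbs = K
  rw [Int.odd_iff] at hu hy
  rw [Int.even_iff] at hx
  rcases v with _ | _ | _ | v
  · omega
  · rw [zero_add, pow_one] at hxu
    rw [zero_add, pow_one, pow_one]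
    have h1 : u % 4 = 1 ∧ x % 8 = 2 ∨ u % 4 = 3 ∧ x % 8 = 6 := by omega
    have h2 : y % 8 = 3 ∧ y % 4 = 3 ∨ y % 8 = 7 ∧ y % 4 = 3 := by omega
    have h3 : (x + y) % 2 = 1 := by omega
    rcases h1 with ⟨h1, h1'⟩ | ⟨h1, h1'⟩ <;> rcases h2 with ⟨h2, h2'⟩ | ⟨h2, h2'⟩ <;>
      simp [h1, h1', h2, h2', h3, Int.add_emod x y 8]
  · have hxu' : x = 4 * u := by rw [hxu]; norm_num
    have hsq : ∀ (p : Prop) [Decidable p], (if p then (1 : ℤ) else -1) ^ (0 + 1 + 1) = 1 := by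
      intro p _
      split_ifs <;> norm_num
    rw [hsq, hsq]
    split_ifs <;> omega
  · obtain ⟨w, hw⟩ : ∃ w, x = 8 * w := ⟨2 ^ v * u, by rw [hxu]; ring⟩
    have hpq : (if (x + y) % 8 = 1 ∨ (x + y) % 8 = 7 then (1 : ℤ) else -1) =
        if y % 8 = 1 ∨ y % 8 = 7 then (1 : ℤ) else -1 := by
      split_ifs <;> omega
    rw [hpq]
    generalize (if y % 8 = 1 ∨ y % 8 = 7 then (1 : ℤ) else -1) ^ (v + 1 + 1 + 1) = L
    rw [if_neg (by omega : ¬ (u % 4 = 3 ∧ y % 4 = 3)), one_mul]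
    split_ifs <;> omega

namespace GridData

/-- Along an edge between an even and an odd circle, the odd curvature is `1` more modulo `4`. -/
theorem Good.emod_of_odd {δ : GridData} (h : Good δ) (hb : δ.b % 2 = 1) :
    (δ.b % 4 = 1 ∧ δ.a % 2 = 0) ∨ (δ.b % 4 = 3 ∧ δ.a % 2 = 1) := by
  have ht := h.type
  have hn := h.null
  obtain ⟨a, b, c, e⟩ := δ
  simp only [IsOne, IsFull] at ht hb hn ⊢
  obtain ⟨β, rfl⟩ : ∃ β, b = 2 * β + 1 := ⟨b / 2, by omega⟩
  obtain ⟨γ, rfl⟩ : ∃ γ, c = 2 * γ := ⟨c / 2, by omega⟩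
  obtain ⟨η, rfl⟩ : ∃ η, e = 4 * η + 1 := ⟨e / 4, by omega⟩
  obtain ⟨r, hr⟩ := Int.even_mul_pred_self β
  obtain ⟨s, hs⟩ := Int.even_mul_pred_self γ
  have : a = β + 2 * (r + s + 2 * η ^ 2 - 2 * η * β - 2 * η * γ - 2 * η * a) := by
    apply mul_left_cancel₀ (four_ne_zero (α := ℤ))
    linear_combination 4 * hr + 4 * hs - hn
  omega

/-- The residues at a horizontal edge between odd circles of a configuration of full type. -/
theorem Good.emod_of_even {δ : GridData} (h : Good δ) (hf : IsFull δ) (hb : δ.b % 2 = 0)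
    (ha : δ.a % 2 = 1) : (δ.a % 4 = 1 ∧ (δ.b % 8 = 0 ∨ δ.b % 8 = 2)) ∨
      (δ.a % 4 = 3 ∧ (δ.b % 8 = 4 ∨ δ.b % 8 = 6)) := by
  have hn := h.null
  obtain ⟨a, b, c, e⟩ := δ
  simp only [IsFull] at hf hb hn ha ⊢
  obtain ⟨β, rfl⟩ : ∃ β, b = 2 * β := ⟨b / 2, by omega⟩
  obtain ⟨γ, rfl⟩ : ∃ γ, c = 2 * γ + 1 := ⟨c / 2, by omega⟩
  obtain ⟨η, rfl⟩ : ∃ η, e = 4 * η + 1 := ⟨e / 4, by omega⟩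
  have key : β * (β - 1) + γ ^ 2 = a + 4 * (η * β + η * γ + η * a - η ^ 2) := by
    apply mul_left_cancel₀ (four_ne_zero (α := ℤ))
    linear_combination hn
  obtain ⟨r, hr⟩ := Int.even_mul_pred_self β
  have hγ : Odd γ := by
    by_contra hn
    rw [Int.not_odd_iff_even] at hn
    obtain ⟨s, rfl⟩ := hn
    have : (s + s) ^ 2 = 4 * s ^ 2 := by ring
    omega
  have h8 := Int.eight_dvd_sq_sub_one_of_odd hγ
  obtain ⟨t, ht⟩ : ∃ t, β = 4 * t + β % 4 := ⟨β / 4, by omega⟩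
  have h4 : β % 4 = 0 ∨ β % 4 = 1 ∨ β % 4 = 2 ∨ β % 4 = 3 := by omega
  have hbb : β * (β - 1) = 4 * (4 * t ^ 2 + t * (2 * (β % 4) - 1)) + (β % 4) * (β % 4 - 1) := by
    nth_rewrite 1 2 [ht]; ring
  rcases h4 with h4 | h4 | h4 | h4 <;> rw [h4] at hbb <;> omega

theorem rep_edge (δ : GridData) : Rep δ (2 * δ.a + δ.b) :=
  ⟨0, 1, isCoprime_one_right, Or.inr ⟨by simp, by simp [qForm]⟩⟩

/-- At the two ends of an edge with coprime curvatures, the sum of these curvatures is represented,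
and quadratic reciprocity shows that `χ₂` is the same. -/
theorem Good.hasVal_star_of_isCoprime {δ : GridData} (h : Good δ)
    (hc : IsCoprime δ.a (δ.a + δ.b)) : ∃ ε, HasVal δ ε ∧ HasVal δ.star ε := by
  have hsum : 2 * δ.a + δ.b = δ.a + (δ.a + δ.b) := by ring
  have hρ := rep_edge δ
  have hρ' : Rep δ.star (2 * δ.a + δ.b) := by
    have := rep_edge δ.star
    convert this using 1
    simp only [GridData.star]; ring
  rw [hsum] at hρ hρ'
  have h1 := isCoprime_add_self_left hc
  have h2 := isCoprime_add_self_right hc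
  have hpos := h.rep_pos hρ h1
  refine ⟨_, ⟨_, hρ, h1, rfl⟩, ⟨_, hρ', h2, ?_⟩⟩
  change SquarePacking.chiTwoExpr δ.a _ = SquarePacking.chiTwoExpr (δ.a + δ.b) _
  have ht := h.type
  rcases Int.emod_two_eq_zero_or_one δ.b with hb | hb
  · rcases Int.emod_two_eq_zero_or_one δ.a with ha | ha
    · exfalso
      obtain ⟨r, hr⟩ := Int.even_iff.2 ha
      obtain ⟨s, hs⟩ := Int.even_iff.2 hb
      obtain ⟨u, v, huv⟩ := hc
      have : 2 * (u * r + v * (r + s)) = 1 := by rw [← huv, hr, hs]; ring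
      omega
    · apply chiTwoExpr_eq_of_odd_of_odd (Int.odd_iff.2 ha) (Int.odd_iff.2 (by omega)) hpos
      rcases ht with ht | ht
      · simp only [IsOne] at ht
        omega
      · have := h.emod_of_even ht hb ha
        omega
  · have := h.emod_of_odd hb
    rcases Int.emod_two_eq_zero_or_one δ.a with ha | ha
    · exact chiTwoExpr_eq_of_even_of_odd (Int.even_iff.2 ha) (Int.odd_iff.2 (by omega)) hc hpos
        (by omega)
    · rw [add_comm] at hpos ⊢
      exact (chiTwoExpr_eq_of_even_of_odd (Int.even_iff.2 (by omega)) (Int.odd_iff.2 ha) hc.symm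
        hpos (by omega)).symm

end GridData

/-! ### Fans of circles along an edge -/

theorem Dvd.dvd.trans_eq {d x y : ℤ} (h : d ∣ x) (e : x = y) : d ∣ y := e ▸ h

theorem isCoprime_of_forall_prime {x y : ℤ}
    (h : ∀ p : ℕ, p.Prime → (p : ℤ) ∣ x → ¬ (p : ℤ) ∣ y) : IsCoprime x y := by
  rw [Int.isCoprime_iff_gcd_eq_one]
  exact Nat.Coprime.gcd_eq_one (Nat.coprime_of_dvd fun p hp hx hy =>
    h p hp (Int.natCast_dvd.2 hx) (Int.natCast_dvd.2 hy))

/-- Conditions modulo finitely many primes can be satisfied simultaneously. -/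
theorem exists_nat_forall_prime_dvd {N : ℤ} (hN : N ≠ 0) (Pr : ℕ → ℕ → Prop)
    (hper : ∀ p m n : ℕ, p.Prime → m ≡ n [MOD p] → Pr p m → Pr p n)
    (hex : ∀ p : ℕ, p.Prime → (p : ℤ) ∣ N → ∃ m, Pr p m) :
    ∃ m, ∀ p : ℕ, p.Prime → (p : ℤ) ∣ N → Pr p m := by
  classical
  choose! f hf using hex
  obtain ⟨m, hm⟩ := Nat.chineseRemainderOfFinset f id N.natAbs.primeFactors
    (fun p hp => (Nat.prime_of_mem_primeFactors hp).ne_zero)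
    (fun p hp q hq hpq => (Nat.coprime_primes (Nat.prime_of_mem_primeFactors hp)
      (Nat.prime_of_mem_primeFactors hq)).2 hpq)
  refine ⟨m, fun p hp hpN => hper p (f p) m hp ?_ (hf p hp hpN)⟩
  exact (hm p (Nat.mem_primeFactors.2 ⟨hp, Int.natCast_dvd.1 hpN, Int.natAbs_ne_zero.2 hN⟩)).symm

theorem Nat.Prime.not_dvd_two_of_ne {p : ℕ} (hp : p.Prime) (h2 : p ≠ 2) : ¬ (p : ℤ) ∣ 2 := by
  intro h
  have : p ∣ 2 := by exact_mod_cast h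
  exact h2 ((Nat.prime_dvd_prime_iff_eq hp Nat.prime_two).1 this)

/-- A quadratic polynomial that is divisible by an odd prime at `0`, `1` and `2` vanishes identically
modulo this prime. -/
theorem dvd_coeff_of_dvd_quadratic {p : ℕ} (hp : p.Prime) (h2 : p ≠ 2) {u s t : ℤ}
    (h0 : (p : ℤ) ∣ u) (h1 : (p : ℤ) ∣ u + 2 * s + 8 * t) (h3 : (p : ℤ) ∣ u + 4 * s + 32 * t) :
    (p : ℤ) ∣ s ∧ (p : ℤ) ∣ t := by
  have hp' := Nat.prime_iff_prime_int.1 hp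
  have hn2 := hp.not_dvd_two_of_ne h2
  have cancel : ∀ x : ℤ, (p : ℤ) ∣ 2 * x → (p : ℤ) ∣ x := fun x hx =>
    (hp'.dvd_or_dvd hx).resolve_left hn2
  have ht : (p : ℤ) ∣ t := by
    have : (p : ℤ) ∣ 2 * (2 * (2 * (2 * t))) := by
      have := (h3.sub (h1.mul_left 2)).add h0
      exact this.trans_eq (by ring)
    exact cancel _ (cancel _ (cancel _ (cancel _ this)))
  refine ⟨cancel _ ?_, ht⟩
  have := (h1.sub h0).sub (ht.mul_left 8)
  exact this.trans_eq (by ring)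

namespace GridData

/-- The configurations that arise by repeated inversion in the two dual circles at the edge to the
right: they contain the same two circles at the ends of this edge. -/
def fan (δ : GridData) (m : ℕ) : GridData :=
  ⟨δ.a, δ.b, δ.c + 2 * m * (2 * (δ.c - δ.e + (2 * δ.a + δ.b))) + 8 * m ^ 2 * (2 * δ.a + δ.b),
    δ.e + 2 * m * (2 * (δ.c - δ.e + (2 * δ.a + δ.b))) + (8 * m ^ 2 - 4 * m) * (2 * δ.a + δ.b)⟩

theorem fan_of_invariant {Pr : GridData → Prop} (hflip : ∀ δ, Pr δ → Pr δ.flip)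
    (hmirror : ∀ δ, Pr δ → Pr δ.swap.mirror.swap) {δ : GridData} (h : Pr δ) (m : ℕ) :
    Pr (δ.fan m) := by
  induction m with
  | zero =>
    convert h using 1
    ext <;> simp [fan]
  | succ m ih =>
    have := hmirror _ (hflip _ (hmirror _ (hflip _ ih)))
    convert this using 1
    ext <;> simp only [fan, flip, swap, mirror] <;> push_cast <;> ring

/-- The two configurations have the same values of `χ₂` at their central circles. -/
def SameVal (δ δ' : GridData) : Prop := ∀ ε, HasVal δ ε ↔ HasVal δ' ε

theorem SameVal.symm {δ δ' : GridData} (h : SameVal δ δ') : SameVal δ' δ := fun ε => (h ε).symm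

theorem SameVal.trans {δ δ' δ'' : GridData} (h : SameVal δ δ') (h' : SameVal δ' δ'') :
    SameVal δ δ'' := fun ε => (h ε).trans (h' ε)

theorem sameVal_swap (δ : GridData) : SameVal δ.swap δ := fun _ =>
  ⟨fun h => h.swap, fun h => h.swap⟩

theorem sameVal_mirror (δ : GridData) : SameVal δ.mirror δ :=
  fun _ => ⟨fun h => by simpa [mirror_mirror] using h.mirror, fun h => h.mirror⟩

theorem sameVal_flip (δ : GridData) : SameVal δ.flip δ :=
  fun _ => ⟨fun h => by simpa [flip_flip] using h.flip, fun h => h.flip⟩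

theorem Good.sameVal {δ δ' : GridData} (h : Good δ) (h' : Good δ') {ε : ℤ} (h1 : HasVal δ ε)
    (h2 : HasVal δ' ε) : SameVal δ δ' := by
  intro ε'
  constructor
  · intro h3; rwa [h.hasVal_unique h3 h1]
  · intro h3; rwa [h'.hasVal_unique h3 h2]

theorem Good.sameVal_star_of_isCoprime {δ : GridData} (h : Good δ)
    (hc : IsCoprime δ.a (δ.a + δ.b)) : SameVal δ δ.star := by
  obtain ⟨ε, h1, h2⟩ := h.hasVal_star_of_isCoprime hc
  exact h.sameVal h.star h1 h2

/-- The fan configurations have the same circles at the ends of the edge, hence the same values. -/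
theorem Good.fan {δ : GridData} (h : Good δ) (m : ℕ) :
    Good (δ.fan m) ∧ SameVal (δ.fan m) δ ∧ SameVal (δ.fan m).star δ.star := by
  refine fan_of_invariant (Pr := fun δ' => Good δ' ∧ SameVal δ' δ ∧ SameVal δ'.star δ.star)
    ?_ ?_ ⟨h, fun _ => Iff.rfl, fun _ => Iff.rfl⟩ m
  · rintro δ' ⟨h1, h2, h3⟩
    refine ⟨h1.flip, (sameVal_flip _).trans h2, ?_⟩
    rw [star_flip]
    exact (sameVal_flip _).trans h3
  · rintro δ' ⟨h1, h2, h3⟩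
    have key : ∀ δ : GridData, SameVal δ.swap.mirror.swap δ := fun δ =>
      (sameVal_swap _).trans ((sameVal_mirror _).trans (sameVal_swap _))
    refine ⟨h1.swap.mirror.swap, (key _).trans h2, ?_⟩
    exact (key δ'.star).trans h3

/-- In a fan there are circles that are not divisible by a given odd prime. -/
theorem Good.exists_fan_prime {δ : GridData} (h : Good δ) {p : ℕ} (hp : p.Prime) (h2 : p ≠ 2) :
    ∃ m, ((p : ℤ) ∣ δ.a ∨ (p : ℤ) ∣ δ.b → ¬ (p : ℤ) ∣ δ.a + (δ.fan m).c) ∧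
      ((p : ℤ) ∣ δ.a + δ.b → ¬ (p : ℤ) ∣ δ.a + δ.b + (δ.fan m).c) := by
  have hp' := Nat.prime_iff_prime_int.1 hp
  have hn2 := hp.not_dvd_two_of_ne h2
  have key : ∀ x : ℤ, ((p : ℤ) ∣ δ.a ∧ (p : ℤ) ∣ δ.b → (p : ℤ) ∣ x) →
      ((p : ℤ) ∣ δ.a ∨ (p : ℤ) ∣ δ.b ∨ (p : ℤ) ∣ δ.a + δ.b) →
      ∃ m, ¬ (p : ℤ) ∣ δ.a + x + (δ.fan m).c := by
    intro x hx hor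
    by_contra! hall
    have h0 := hall 0
    have h1 := hall 1
    have h3 := hall 2
    simp only [GridData.fan] at h0 h1 h3
    push_cast at h0 h1 h3
    obtain ⟨hs, ht⟩ := dvd_coeff_of_dvd_quadratic hp h2 (u := δ.a + x + δ.c)
      (s := 2 * (δ.c - δ.e + (2 * δ.a + δ.b))) (t := 2 * δ.a + δ.b)
      (h0.trans_eq (by ring)) (h1.trans_eq (by ring)) (h3.trans_eq (by ring))
    have hab : (p : ℤ) ∣ δ.a ∧ (p : ℤ) ∣ δ.b := by
      rcases hor with hor | hor | hor
      · refine ⟨hor, ?_⟩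
        have := ht.sub (hor.mul_left 2)
        exact this.trans_eq (by ring)
      · refine ⟨(hp'.dvd_or_dvd ?_).resolve_left hn2, hor⟩
        have := ht.sub hor
        exact this.trans_eq (by ring)
      · have ha : (p : ℤ) ∣ δ.a := by
          have := ht.sub hor
          exact this.trans_eq (by ring)
        refine ⟨ha, ?_⟩
        have := hor.sub ha
        exact this.trans_eq (by ring)
    have hc : (p : ℤ) ∣ δ.c := by
      have h4 : (p : ℤ) ∣ δ.a + x + δ.c := h0.trans_eq (by ring)
      have := (h4.sub hab.1).sub (hx hab)
      exact this.trans_eq (by ring)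
    have he : (p : ℤ) ∣ δ.e := by
      have := (hc.add ht).sub ((hp'.dvd_or_dvd hs).resolve_left hn2)
      exact this.trans_eq (by ring)
    exact hp'.not_isUnit (h.prim p ⟨hab.1, hab.2, hc, he⟩)
  by_cases h1 : (p : ℤ) ∣ δ.a ∨ (p : ℤ) ∣ δ.b
  · obtain ⟨m, hm⟩ := key 0 (fun _ => dvd_zero _) (by tauto)
    rw [add_zero] at hm
    refine ⟨m, fun _ => hm, fun h3 h4 => hm ?_⟩
    have hb : (p : ℤ) ∣ δ.b := by
      rcases h1 with h1 | h1
      · simpa using h3.sub h1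
      · exact h1
    have := h4.sub hb
    exact this.trans_eq (by ring)
  · by_cases h3 : (p : ℤ) ∣ δ.a + δ.b
    · obtain ⟨m, hm⟩ := key δ.b (fun h => h.2) (by tauto)
      exact ⟨m, fun h => absurd h h1, fun _ => hm⟩
    · exact ⟨0, fun h => absurd h h1, fun h => absurd h h3⟩

theorem fan_c_modEq (δ : GridData) {p m n : ℕ} (h : m ≡ n [MOD p]) :
    (p : ℤ) ∣ (δ.fan m).c - (δ.fan n).c := by
  have h1 : (p : ℤ) ∣ (m : ℤ) - n := by
    have := (Nat.modEq_iff_dvd.1 h.symm)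
    exact this
  have : (δ.fan m).c - (δ.fan n).c = ((m : ℤ) - n) *
    (2 * (2 * (δ.c - δ.e + (2 * δ.a + δ.b))) + 8 * (m + n) * (2 * δ.a + δ.b)) := by
    simp only [GridData.fan]; ring
  rw [this]
  exact h1.mul_right _

/-- The simultaneous choice of a member of the fan for all odd primes that divide `N`. -/
theorem Good.exists_fan {δ : GridData} (h : Good δ) {N : ℤ} (hN : N ≠ 0) :
    ∃ m, ∀ p : ℕ, p.Prime → (p : ℤ) ∣ N → p ≠ 2 →
      ((p : ℤ) ∣ δ.a ∨ (p : ℤ) ∣ δ.b → ¬ (p : ℤ) ∣ δ.a + (δ.fan m).c) ∧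
      ((p : ℤ) ∣ δ.a + δ.b → ¬ (p : ℤ) ∣ δ.a + δ.b + (δ.fan m).c) := by
  refine exists_nat_forall_prime_dvd hN (fun p m => p ≠ 2 →
      ((p : ℤ) ∣ δ.a ∨ (p : ℤ) ∣ δ.b → ¬ (p : ℤ) ∣ δ.a + (δ.fan m).c) ∧
      ((p : ℤ) ∣ δ.a + δ.b → ¬ (p : ℤ) ∣ δ.a + δ.b + (δ.fan m).c)) ?_ ?_
  · intro p m n hp hmn h1 h2
    obtain ⟨h3, h4⟩ := h1 h2
    have h5 := δ.fan_c_modEq hmn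
    have h6 : ∀ x : ℤ, (p : ℤ) ∣ x + (δ.fan n).c → (p : ℤ) ∣ x + (δ.fan m).c := by
      intro x hx
      have := hx.add h5
      exact this.trans_eq (by ring)
    exact ⟨fun h7 h8 => h3 h7 (h6 _ h8), fun h7 h8 => h4 h7 (h6 _ h8)⟩
  · intro p hp _
    by_cases h2 : p = 2
    · exact ⟨0, fun h => absurd h2 h⟩
    · obtain ⟨m, hm⟩ := h.exists_fan_prime hp h2
      exact ⟨m, fun _ => hm⟩

theorem fan_c_emod_two (δ : GridData) (m : ℕ) : (δ.fan m).c % 2 = δ.c % 2 := by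
  simp only [GridData.fan]
  have : δ.c + 2 * m * (2 * (δ.c - δ.e + (2 * δ.a + δ.b))) + 8 * m ^ 2 * (2 * δ.a + δ.b) =
    δ.c + 2 * (m * (2 * (δ.c - δ.e + (2 * δ.a + δ.b))) + 4 * m ^ 2 * (2 * δ.a + δ.b)) := by ring
  omega

theorem not_two_dvd_of_odd {x : ℤ} (h : x % 2 = 1) : ¬ ((2 : ℕ) : ℤ) ∣ x := by
  push_cast
  omega

/-! ### Existence of a value -/

theorem Good.exists_hasVal_of_odd {δ : GridData} (h : Good δ) (ha : δ.a ≠ 0)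
    (hodd : δ.a % 2 = 1 ∨ δ.c % 2 = 1) : ∃ ε, HasVal δ ε := by
  obtain ⟨m, hm⟩ := h.exists_fan ha
  obtain ⟨hg, hs, -⟩ := h.fan m
  have hc : IsCoprime δ.a (δ.a + (δ.fan m).c) := by
    apply isCoprime_of_forall_prime
    intro p hp hpa
    by_cases h2 : p = 2
    · subst h2
      apply not_two_dvd_of_odd
      have := δ.fan_c_emod_two m
      push_cast at hpa
      omega
    · exact (hm p hp hpa h2).1 (Or.inl hpa)
  obtain ⟨ε, h1, -⟩ := hg.swap.hasVal_star_of_isCoprime hc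
  exact ⟨ε, (hs ε).1 ((sameVal_swap _ ε).1 h1)⟩

/-- The configurations around a line come from primitive Pythagorean triples. -/
theorem Good.exists_of_zero {δ : GridData} (h : Good δ) (ha : δ.a = 0) (hb : δ.b % 2 = 0) :
    ∃ m n : ℤ, IsCoprime m n ∧ (m + n) % 2 = 1 ∧ δ.b = 2 * m ^ 2 ∧ δ.c = (m + n) ^ 2 ∧
      δ.e = m ^ 2 + n ^ 2 := by
  have hf : IsFull δ := by
    have := h.type
    simp only [IsOne] at this
    rcases this with h | h
    · omega
    · exact h
  have hd := h.disc
  have hpos := h.pos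
  rw [ha] at hd hpos
  have hpt : PythagoreanTriple (δ.b - δ.e) (δ.c - δ.e) δ.e := by
    rw [PythagoreanTriple]; linear_combination -hd
  have hcop : Int.gcd (δ.b - δ.e) (δ.c - δ.e) = 1 := by
    rw [← Int.isCoprime_iff_gcd_eq_one]
    apply isCoprime_of_forall_prime
    intro p hp h1 h2
    have hp' := Nat.prime_iff_prime_int.1 hp
    have he : (p : ℤ) ∣ δ.e := by
      apply hp'.dvd_of_dvd_pow (n := 2)
      have := (h1.mul_left (δ.b - δ.e)).add (h2.mul_left (δ.c - δ.e))
      exact this.trans_eq (by linear_combination -hd)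
    refine hp'.not_isUnit (h.prim p ⟨by simp [ha], ?_, ?_, he⟩)
    · simpa using h1.add he
    · simpa using h2.add he
  rw [IsFull] at hf
  obtain ⟨m, n, h1, h2, h3, h4, h5, -⟩ := hpt.coprime_classification' hcop (by omega) (by omega)
  refine ⟨m, n, Int.isCoprime_iff_gcd_eq_one.2 h4, by omega, ?_, ?_, h3⟩
  · linear_combination h1 + h3
  · linear_combination h2 + h3

theorem Good.hasVal_of_zero {δ : GridData} (h : Good δ) (ha : δ.a = 0) : HasVal δ 1 := by
  have key : ∀ {δ : GridData}, Good δ → δ.a = 0 → δ.b % 2 = 0 → HasVal δ 1 := by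
    intro δ h ha hb
    obtain ⟨m, n, hc, hodd, h1, h2, h3⟩ := h.exists_of_zero ha hb
    obtain ⟨u, v, huv⟩ := hc
    have rep : ∀ x y : ℤ, x % 2 = 1 → y % 2 = 1 → x * n + y * m = 1 → HasVal δ 1 := by
      intro x y hx hy hxy
      refine ⟨1, ⟨x, y, ⟨n, m, by linear_combination hxy⟩, Or.inl ⟨?_, ?_⟩⟩,
        isCoprime_one_left, ?_⟩
      · exact (Int.odd_iff.2 hx).mul (Int.odd_iff.2 hy)
      · rw [qForm, ha, h1, h2, h3]
        linear_combination (-2 * (x * n + y * m + 1)) * hxy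
      · rw [ha]
        simp [SquarePacking.chiTwoExpr, kroneckerSymbol]
    -- of `m` and `n`, one is even, so that one of `u` and `v` is odd; the other one can be adjusted
    have hpar : ∀ x y z : ℤ, x % 2 = 1 → (y + x * z) % 2 = (y + z) % 2 := by
      intro x y z hx
      rw [Int.add_emod, Int.mul_emod, hx, one_mul, Int.emod_emod, ← Int.add_emod]
    rcases Int.emod_two_eq_zero_or_one m with hm | hm
    · have hn : n % 2 = 1 := by omega
      have hv : v % 2 = 1 := by
        have : (v * n) % 2 = 1 := by
          obtain ⟨k, hk⟩ := Int.even_iff.2 hm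
          have : v * n = 1 - 2 * (u * k) := by rw [← huv, hk]; ring
          omega
        exact Int.odd_iff.1 (Int.odd_mul.1 (Int.odd_iff.2 this)).1
      rcases Int.emod_two_eq_zero_or_one u with hu | hu
      · exact rep (v - m) (u + n) (by omega) (by omega) (by linear_combination huv)
      · exact rep v u hv hu (by linear_combination huv)
    · have hn : n % 2 = 0 := by omega
      have hu : u % 2 = 1 := by
        have : (u * m) % 2 = 1 := by
          obtain ⟨k, hk⟩ := Int.even_iff.2 hn
          have : u * m = 1 - 2 * (v * k) := by rw [← huv, hk]; ring
          omega
        exact Int.odd_iff.1 (Int.odd_mul.1 (Int.odd_iff.2 this)).1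
      rcases Int.emod_two_eq_zero_or_one v with hv | hv
      · exact rep (v + m) (u - n) (by omega) (by omega) (by linear_combination huv)
      · exact rep v u hv hu (by linear_combination huv)
  rcases Int.emod_two_eq_zero_or_one δ.b with hb | hb
  · exact key h ha hb
  · refine (sameVal_swap δ 1).1 (key h.swap ha ?_)
    have := h.type
    simp only [IsOne, IsFull, GridData.swap] at this ⊢
    omega

/-- At every circle there is an admissible integer. -/
theorem Good.exists_hasVal {δ : GridData} (h : Good δ) : ∃ ε, HasVal δ ε := by
  by_cases ha : δ.a = 0
  · exact ⟨1, h.hasVal_of_zero ha⟩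
  by_cases hodd : δ.a % 2 = 1 ∨ δ.c % 2 = 1
  · exact h.exists_hasVal_of_odd ha hodd
  · have ht := h.type
    obtain ⟨ε, hε⟩ := h.swap.exists_hasVal_of_odd ha (by
      simp only [IsOne, IsFull, GridData.swap] at ht ⊢
      omega)
    exact ⟨ε, (sameVal_swap δ ε).1 hε⟩

/-- A right neighbour of even curvature of a line has a curvature of the form `2 m²`, which forces
the value `1`. -/
theorem Good.hasVal_star_of_zero {δ : GridData} (h : Good δ) (ha : δ.a = 0) (hb : δ.b % 2 = 0)
    (hb0 : δ.b ≠ 0) : HasVal δ.star 1 := by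
  obtain ⟨m, n, hc, hodd, h1, h2, h3⟩ := h.exists_of_zero ha hb
  have hm0 : m ≠ 0 := by
    rintro rfl
    simp [h1] at hb0
  have hA : δ.star.a = 2 * m ^ 2 := by simp [GridData.star, ha, h1]
  have hrep : Rep δ.star (4 * m ^ 2 + (m + n) ^ 2) := by
    have := (rep_edge δ.star.swap).swap
    have hsum : 2 * δ.star.swap.a + δ.star.swap.b = 4 * m ^ 2 + (m + n) ^ 2 := by
      change 2 * (δ.a + δ.b) + δ.c = _
      rw [ha, h1, h2]
      ring
    rwa [hsum, swap_swap] at this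
  have hodd2 : Odd (m + n) := Int.odd_iff.2 hodd
  have h8 := Int.eight_dvd_sq_sub_one_of_odd hodd2
  have hcm : IsCoprime (4 * m ^ 2 + (m + n) ^ 2) m := by
    have h4 : IsCoprime (m + n) m := isCoprime_add_self_left hc
    have h5 : IsCoprime ((m + n) ^ 2) m := h4.pow_left
    have := h5.add_mul_right_left (4 * m)
    rwa [show (m + n) ^ 2 + 4 * m * m = 4 * m ^ 2 + (m + n) ^ 2 by ring] at this
  have hc2 : IsCoprime (4 * m ^ 2 + (m + n) ^ 2) 2 := by
    obtain ⟨k, hk⟩ := h8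
    exact ⟨1, -(2 * m ^ 2 + 4 * k), by linear_combination hk⟩
  have hcop : IsCoprime (4 * m ^ 2 + (m + n) ^ 2) δ.star.a := by
    rw [hA]
    exact hc2.mul_right hcm.pow_right
  refine ⟨_, hrep, hcop, ?_⟩
  have hpos := h.star.rep_pos hrep hcop
  rw [hA, _root_.chiTwoExpr_eq]
  obtain ⟨v, u, hu, hmu⟩ := Int.exists_eq_two_pow_mul_odd hm0
  have hcu : IsCoprime (4 * m ^ 2 + (m + n) ^ 2) u := by
    have h5 := hcm
    rw [show IsCoprime (4 * m ^ 2 + (m + n) ^ 2) m ↔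
      IsCoprime (4 * m ^ 2 + (m + n) ^ 2) (2 ^ v * u) by rw [← hmu]] at h5
    exact h5.of_mul_right_right
  have hk : kroneckerSymbol (4 * m ^ 2 + (m + n) ^ 2) (2 * m ^ 2) =
      ZMod.χ₈ ((4 * m ^ 2 + (m + n) ^ 2 : ℤ) : ZMod 8) := by
    have h5 : 2 * m ^ 2 = 2 ^ (2 * v + 1) * u ^ 2 := by rw [hmu]; ring
    rw [h5, kroneckerSymbol_two_pow_mul _ hu.pow hpos, Int.natAbs_pow,
      jacobiSym.pow_right, jacobiSym.sq_one (isCoprime_natAbs_gcd hcu), mul_one]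
    rw [chi8_of_odd (by rw [Int.odd_iff]; omega)]
    split_ifs
    · exact one_pow _
    · exact Odd.neg_one_pow ⟨v, rfl⟩
  have hk' : Odd (4 * m ^ 2 + (m + n) ^ 2) := by rw [Int.odd_iff]; omega
  rw [hk, chi8_of_odd hk', chiSign]
  rcases Int.even_or_odd m with hm | hm
  · obtain ⟨k, rfl⟩ := hm
    have h6 : (k + k) ^ 2 = 4 * k ^ 2 := by ring
    rw [if_neg (by omega), if_neg (by omega), if_neg (by omega), if_pos (by omega), one_mul]
  · have h6 := Int.eight_dvd_sq_sub_one_of_odd hm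
    rw [if_neg (by omega), if_neg (by omega), if_pos (by omega), if_neg (by omega)]
    norm_num

/-! ### The invariant along edges -/

/-- Three sides of a square in a fan suffice to compare the ends of the fourth side. -/
theorem Good.sameVal_star_of_fan {δ : GridData} (h : Good δ) (m : ℕ)
    (h1 : SameVal (δ.fan m).swap (δ.fan m).swap.star)
    (h2 : SameVal (δ.fan m).swap.star.swap (δ.fan m).swap.star.swap.star)
    (h3 : SameVal (δ.fan m).star.swap (δ.fan m).star.swap.star) : SameVal δ δ.star := by
  obtain ⟨-, hs, hs'⟩ := h.fan m
  have hcomm : (δ.fan m).star.swap.star.swap = (δ.fan m).swap.star.swap.star := by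
    ext <;> simp only [GridData.star, GridData.swap]
    ring
  have e1 : SameVal δ (δ.fan m).swap.star.swap.star :=
    hs.symm.trans ((sameVal_swap _).symm.trans (h1.trans ((sameVal_swap _).symm.trans h2)))
  have e2 : SameVal (δ.fan m).swap.star.swap.star δ.star := by
    rw [← hcomm]
    exact (sameVal_swap _).trans (h3.symm.trans ((sameVal_swap _).trans hs'))
  exact e1.trans e2

theorem Good.sameVal_star_of_odd_neighbours {δ : GridData} (h : Good δ) (hb : δ.b % 2 = 0)
    (hodd : (δ.a + δ.c) % 2 = 1) : SameVal δ δ.star := by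
  by_cases hb0 : δ.b = 0
  · have : δ.star = δ := by ext <;> simp [GridData.star, hb0]
    rw [this]
    exact fun _ => Iff.rfl
  by_cases ha : δ.a = 0
  · exact h.sameVal h.star (h.hasVal_of_zero ha) (h.hasVal_star_of_zero ha hb hb0)
  by_cases hab : δ.a + δ.b = 0
  · have h1 := h.star.hasVal_of_zero hab
    have h2 := h.star.hasVal_star_of_zero hab (by simp only [GridData.star]; omega)
      (by simpa [GridData.star] using hb0)
    rw [star_star] at h2
    exact h.sameVal h.star h2 h1
  obtain ⟨m, hm⟩ := h.exists_fan (mul_ne_zero (mul_ne_zero ha hb0) hab)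
  have hpar := δ.fan_c_emod_two m
  obtain ⟨hg, -⟩ := h.fan m
  have c1 : IsCoprime δ.a (δ.a + (δ.fan m).c) := by
    apply isCoprime_of_forall_prime
    intro p hp hpa
    by_cases h2 : p = 2
    · subst h2
      exact not_two_dvd_of_odd (by omega)
    · exact (hm p hp ((hpa.mul_right _).mul_right _) h2).1 (Or.inl hpa)
  have c2 : IsCoprime (δ.a + (δ.fan m).c) (δ.a + (δ.fan m).c + δ.b) := by
    apply isCoprime_of_forall_prime
    intro p hp hp1 hp2
    have hpb : (p : ℤ) ∣ δ.b := by simpa using hp2.sub hp1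
    by_cases h2 : p = 2
    · subst h2
      exact not_two_dvd_of_odd (by omega) hp1
    · exact (hm p hp ((hpb.mul_left _).mul_right _) h2).1 (Or.inr hpb) hp1
  have c3 : IsCoprime (δ.a + δ.b) (δ.a + δ.b + (δ.fan m).c) := by
    apply isCoprime_of_forall_prime
    intro p hp hpa
    by_cases h2 : p = 2
    · subst h2
      exact not_two_dvd_of_odd (by omega)
    · exact (hm p hp (hpa.mul_left _) h2).2 hpa
  exact h.sameVal_star_of_fan m (hg.swap.sameVal_star_of_isCoprime c1)
    (hg.swap.star.swap.sameVal_star_of_isCoprime c2)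
    (hg.star.swap.sameVal_star_of_isCoprime c3)

theorem Good.sameVal_star_of_even {δ : GridData} (h : Good δ) (hb : δ.b % 2 = 0) :
    SameVal δ δ.star := by
  by_cases hodd : (δ.a + δ.c) % 2 = 1
  · exact h.sameVal_star_of_odd_neighbours hb hodd
  have hac : δ.a % 2 = 1 ∧ δ.c % 2 = 1 := by
    have := h.type
    simp only [IsOne, IsFull] at this
    omega
  obtain ⟨m, hm⟩ := h.exists_fan (N := δ.a * (δ.a + δ.b)) (mul_ne_zero (by omega) (by omega))
  have hpar := δ.fan_c_emod_two m
  obtain ⟨hg, -⟩ := h.fan m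
  have c1 : IsCoprime δ.a (δ.a + (δ.fan m).c) := by
    apply isCoprime_of_forall_prime
    intro p hp hpa
    by_cases h2 : p = 2
    · subst h2
      exact absurd hpa (not_two_dvd_of_odd hac.1)
    · exact (hm p hp (hpa.mul_right _) h2).1 (Or.inl hpa)
  have c3 : IsCoprime (δ.a + δ.b) (δ.a + δ.b + (δ.fan m).c) := by
    apply isCoprime_of_forall_prime
    intro p hp hpa
    by_cases h2 : p = 2
    · subst h2
      exact absurd hpa (not_two_dvd_of_odd (by omega))
    · exact (hm p hp (hpa.mul_left _) h2).2 hpa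
  refine h.sameVal_star_of_fan m (hg.swap.sameVal_star_of_isCoprime c1) ?_
    (hg.star.swap.sameVal_star_of_isCoprime c3)
  apply hg.swap.star.swap.sameVal_star_of_odd_neighbours
  · exact hb
  · change (δ.a + (δ.fan m).c + -(δ.fan m).c) % 2 = 1
    omega

/-- `χ₂` is the same at the two ends of an edge. -/
theorem Good.sameVal_star {δ : GridData} (h : Good δ) : SameVal δ δ.star := by
  by_cases hb : δ.b % 2 = 0
  · exact h.sameVal_star_of_even hb
  have hc : δ.c % 2 = 0 := by
    have := h.type
    simp only [IsOne, IsFull] at this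
    omega
  obtain ⟨m, hm⟩ := h.exists_fan (N := δ.b) (by omega)
  have hpar := δ.fan_c_emod_two m
  obtain ⟨hg, -⟩ := h.fan m
  have c2 : IsCoprime (δ.a + (δ.fan m).c) (δ.a + (δ.fan m).c + δ.b) := by
    apply isCoprime_of_forall_prime
    intro p hp hp1 hp2
    have hpb : (p : ℤ) ∣ δ.b := by simpa using hp2.sub hp1
    by_cases h2 : p = 2
    · subst h2
      exact not_two_dvd_of_odd (by omega) hpb
    · exact (hm p hp hpb h2).1 (Or.inr hpb) hp1
  refine h.sameVal_star_of_fan m (hg.swap.sameVal_star_of_even ?_)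
    (hg.swap.star.swap.sameVal_star_of_isCoprime c2) (hg.star.swap.sameVal_star_of_even ?_)
  · exact hpar.trans hc
  · exact hpar.trans hc

theorem Good.hasVal_star {δ : GridData} (h : Good δ) {ε : ℤ} (hε : HasVal δ ε) :
    HasVal δ.star ε := (h.sameVal_star ε).1 hε

end GridData

/-- Where the curvature is a square, the Kronecker symbol is `1`. -/
theorem GridData.Good.hasVal_of_sq {δ : GridData} (h : δ.Good) {n : ℤ} (ha : δ.a = n ^ 2) {ε : ℤ}
    (hε : δ.HasVal ε) : ε = 1 := by
  by_cases hn : n = 0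
  · rw [hn, zero_pow two_ne_zero] at ha
    exact h.hasVal_unique hε (h.hasVal_of_zero ha)
  · obtain ⟨ρ, hρ, hc, rfl⟩ := hε
    have hpos := h.rep_pos hρ hc
    rw [ha] at hc ⊢
    rw [_root_.chiTwoExpr_eq, kroneckerSymbol_sq_right hn hpos
      ((IsCoprime.pow_right_iff two_pos).1 hc), chiSign, mul_one]
    have h8 : n ^ 2 % 8 = 0 ∨ n ^ 2 % 8 = 1 ∨ n ^ 2 % 8 = 4 := by
      rcases Int.even_or_odd n with ⟨k, rfl⟩ | hn
      · rcases Int.even_or_odd k with ⟨l, rfl⟩ | hk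
        · have : (l + l + (l + l)) ^ 2 = 8 * (2 * l ^ 2) := by ring
          omega
        · have h1 := Int.eight_dvd_sq_sub_one_of_odd hk
          have : (k + k) ^ 2 = 4 * k ^ 2 := by ring
          omega
      · have := Int.eight_dvd_sq_sub_one_of_odd hn
        omega
    split_ifs <;> omega

/-! ### Möbius transformations and curvatures -/

theorem OrientedCircle.reflect_apply (D X : OrientedCircle) :
    D.reflect X = OrientedCircle.reflectFun D X := rfl

theorem OrientedCircle.reflect_inv (D : OrientedCircle) : D.reflect⁻¹ = D.reflect := by
  rw [inv_eq_iff_mul_eq_one]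
  ext1 X
  exact OrientedCircle.reflectFun_involutive D X

theorem OrientedCircle.inversiveProduct_reflect (K X D : OrientedCircle) :
    (K.reflect X).inversiveProduct (K.reflect D) = X.inversiveProduct D := by
  have hK := K.norm_eq
  simp only [reflect_apply, reflectFun, inversiveProduct]
  linear_combination 4 * (X.h₁ * K.h₁ + X.h₂ * K.h₂ - (X.curv * K.cocurv + X.cocurv * K.curv) / 2) *
    (D.h₁ * K.h₁ + D.h₂ * K.h₂ - (D.curv * K.cocurv + D.cocurv * K.curv) / 2) * hK

theorem OrientedCircle.reflect_reflect (K D X : OrientedCircle) :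
    K.reflect (D.reflect X) = (K.reflect D).reflect (K.reflect X) := by
  have h := inversiveProduct_reflect K X D
  rw [reflect_apply (K.reflect D), reflectFun]
  simp only [h]
  ext <;> simp only [reflect_apply, reflectFun, inversiveProduct] <;> ring

/-- A Möbius transformation conjugates the inversion in a circle to the inversion in its image. -/
theorem moebius_reflect {f : Equiv.Perm OrientedCircle} (hf : f ∈ moebiusGroup) :
    ∀ D X : OrientedCircle, f (D.reflect X) = (f D).reflect (f X) := by
  induction hf using Subgroup.closure_induction with
  | mem f hf =>
    obtain ⟨K, rfl⟩ := hf
    exact OrientedCircle.reflect_reflect K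
  | one => exact fun _ _ => rfl
  | mul f g _ _ hf hg => exact fun D X => by rw [Equiv.Perm.mul_apply, hg, hf]; rfl
  | inv f _ hf =>
    intro D X
    apply f.injective
    rw [hf]
    simp

/-- The curvature of the image under a Möbius transformation is the inversive product with a null
vector, which moreover is future-directed. -/
theorem moebius_curv {f : Equiv.Perm OrientedCircle} (hf : f ∈ moebiusGroup) :
    ∃ p q r s : ℝ, 0 ≤ p ∧ 0 ≤ q ∧ r ^ 2 + s ^ 2 = 4 * p * q ∧
      ∀ X : OrientedCircle, (f X).curv = p * X.cocurv + q * X.curv + r * X.h₁ + s * X.h₂ := by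
  have step : ∀ (f : Equiv.Perm OrientedCircle) (D : OrientedCircle),
      (∃ p q r s : ℝ, 0 ≤ p ∧ 0 ≤ q ∧ r ^ 2 + s ^ 2 = 4 * p * q ∧
        ∀ X : OrientedCircle, (f X).curv = p * X.cocurv + q * X.curv + r * X.h₁ + s * X.h₂) →
      ∃ p q r s : ℝ, 0 ≤ p ∧ 0 ≤ q ∧ r ^ 2 + s ^ 2 = 4 * p * q ∧
        ∀ X : OrientedCircle,
          ((f * D.reflect) X).curv = p * X.cocurv + q * X.curv + r * X.h₁ + s * X.h₂ := by
    rintro f D ⟨p, q, r, s, hp, hq, hn, hX⟩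
    have hD := D.norm_eq
    have nonneg : ∀ p q t : ℝ, 0 ≤ p → 0 ≤ q → r ^ 2 + s ^ 2 = 4 * p * q →
        0 ≤ p * (D.h₁ ^ 2 + D.h₂ ^ 2) + q * t ^ 2 + t * (r * D.h₁ + s * D.h₂) := by
      intro p q t hp hq hn
      rcases hp.eq_or_lt with hp0 | hp0
      · have hr : r = 0 := by nlinarith [sq_nonneg r, sq_nonneg s]
        have hs : s = 0 := by nlinarith [sq_nonneg r, sq_nonneg s]
        rw [← hp0, hr, hs]
        have := mul_nonneg hq (sq_nonneg t)
        linarith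
      · have h1 : 4 * p * (p * (D.h₁ ^ 2 + D.h₂ ^ 2) + q * t ^ 2 + t * (r * D.h₁ + s * D.h₂)) =
            (2 * p * D.h₁ + t * r) ^ 2 + (2 * p * D.h₂ + t * s) ^ 2 := by
          linear_combination -t ^ 2 * hn
        have h2 : 0 ≤ 4 * p *
            (p * (D.h₁ ^ 2 + D.h₂ ^ 2) + q * t ^ 2 + t * (r * D.h₁ + s * D.h₂)) := by
          rw [h1]; positivity
        exact nonneg_of_mul_nonneg_right h2 (by positivity)
    -- the value of the functional at the mirror
    set L := p * D.cocurv + q * D.curv + r * D.h₁ + s * D.h₂ with hL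
    refine ⟨p + L * D.curv, q + L * D.cocurv, r - 2 * L * D.h₁, s - 2 * L * D.h₂, ?_, ?_, ?_, ?_⟩
    · have := nonneg p q D.curv hp hq hn
      have e : p + L * D.curv =
          p * (D.h₁ ^ 2 + D.h₂ ^ 2) + q * D.curv ^ 2 + D.curv * (r * D.h₁ + s * D.h₂) := by
        rw [hL]; linear_combination -p * hD
      rwa [e]
    · have := nonneg q p D.cocurv hq hp (by rw [hn]; ring)
      have e : q + L * D.cocurv =
          q * (D.h₁ ^ 2 + D.h₂ ^ 2) + p * D.cocurv ^ 2 + D.cocurv * (r * D.h₁ + s * D.h₂) := by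
        rw [hL]; linear_combination -q * hD
      rwa [e]
    · rw [hL]
      linear_combination hn + 4 * L ^ 2 * hD
    · intro X
      rw [Equiv.Perm.mul_apply, hX, OrientedCircle.reflect_apply, hL]
      simp only [OrientedCircle.reflectFun, OrientedCircle.inversiveProduct]
      ring
  induction hf using Subgroup.closure_induction_right with
  | one => exact ⟨0, 1, 0, 0, le_rfl, zero_le_one, by norm_num, fun X => by simp⟩
  | mul_right f _ D hD ih =>
    obtain ⟨D, rfl⟩ := hD
    exact step f D ih
  | mul_inv_cancel f _ D hD ih =>
    obtain ⟨D, rfl⟩ := hD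
    rw [OrientedCircle.reflect_inv]
    exact step f D ih

/-- The group generated by the inversions in the dual circles of the square tiling. -/
def tilingGroup : Subgroup (Equiv.Perm OrientedCircle) :=
  Subgroup.closure (Set.range fun f => (tilingDual f).reflect)

theorem tilingGroup_induction {Pr : Equiv.Perm OrientedCircle → Prop} (one : Pr 1)
    (step : ∀ h ∈ tilingGroup, Pr h → ∀ f g : ℤ, Pr (h * (tilingDual (f, g)).reflect))
    {h : Equiv.Perm OrientedCircle} (hh : h ∈ tilingGroup) : Pr h := by
  induction hh using Subgroup.closure_induction_right with
  | one => exact one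
  | mul_right h hh D hD ih =>
    obtain ⟨⟨f, g⟩, rfl⟩ := hD
    exact step h hh ih f g
  | mul_inv_cancel h hh D hD ih =>
    obtain ⟨⟨f, g⟩, rfl⟩ := hD
    simp only [OrientedCircle.reflect_inv]
    exact step h hh ih f g

theorem reflect_mem_tilingGroup (f g : ℤ) : (tilingDual (f, g)).reflect ∈ tilingGroup :=
  Subgroup.subset_closure ⟨(f, g), rfl⟩

namespace SquarePacking

variable (A : SquarePacking)

/-- The configurations of the packing are the images, under the base position, of those of the
tiling. -/
theorem exists_tilingGroup {g : Equiv.Perm OrientedCircle} (hg : g ∈ A.apollonianGroup) :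
    ∃ h ∈ tilingGroup, g * A.position = A.position * h := by
  induction hg using Subgroup.closure_induction with
  | mem g hg =>
    obtain ⟨⟨f, f'⟩, rfl⟩ := hg
    refine ⟨_, reflect_mem_tilingGroup f f', ?_⟩
    ext1 X
    exact (moebius_reflect A.position.2 _ X).symm
  | one => exact ⟨1, one_mem _, by simp⟩
  | mul g g' _ _ hg hg' =>
    obtain ⟨h, hh, e⟩ := hg
    obtain ⟨h', hh', e'⟩ := hg'
    exact ⟨h * h', mul_mem hh hh', by rw [mul_assoc, e', ← mul_assoc, e, mul_assoc]⟩
  | inv g _ hg =>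
    obtain ⟨h, hh, e⟩ := hg
    exact ⟨h⁻¹, inv_mem hh, by rw [inv_mul_eq_iff_eq_mul, ← mul_assoc, e, mul_inv_cancel_right]⟩

theorem exists_apollonianGroup {h : Equiv.Perm OrientedCircle} (hh : h ∈ tilingGroup) :
    ∃ g ∈ A.apollonianGroup, g * A.position = A.position * h := by
  refine tilingGroup_induction (Pr := fun h => ∃ g ∈ A.apollonianGroup,
    g * A.position = A.position * h) ⟨1, one_mem _, by simp⟩ ?_ hh
  rintro h - ⟨g, hg, e⟩ f f'
  refine ⟨g * (A.dual (f, f')).reflect,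
    mul_mem hg (Subgroup.subset_closure ⟨(f, f'), rfl⟩), ?_⟩
  rw [← mul_assoc, ← e, mul_assoc, mul_assoc]
  congr 1
  ext1 X
  exact (moebius_reflect A.position.2 _ X).symm

theorem apply_base {g h : Equiv.Perm OrientedCircle} (e : g * A.position = A.position * h)
    (p : ℤ × ℤ) : g (A.base p) = (A.position * h : Equiv.Perm OrientedCircle) (tilingCircle p) := by
  rw [← e]; rfl

end SquarePacking

/-- The curvatures of the images of all circles under `M` are governed by `δ`. -/
def IsData (M : Equiv.Perm OrientedCircle) (δ : GridData) : Prop :=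
  ∀ X : OrientedCircle, (M X).curv = δ.a * X.curv + δ.b * (X.h₁ / 2) + δ.c * (X.h₂ / 2) +
    δ.e * ((X.cocurv + X.curv - 2 * X.h₁ - 2 * X.h₂) / 4)

theorem IsData.curv {M : Equiv.Perm OrientedCircle} {δ : GridData} (h : IsData M δ) (i j : ℤ) :
    (M (tilingCircle (i, j))).curv = ((δ.shift i j).a : ℝ) := by
  rw [h]
  simp only [tilingCircle, GridData.shift]
  push_cast
  ring

theorem IsData.unique {M : Equiv.Perm OrientedCircle} {δ δ' : GridData} (h : IsData M δ)
    (h' : IsData M δ') : δ = δ' := by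
  have key : ∀ i j : ℤ, (δ.shift i j).a = (δ'.shift i j).a := by
    intro i j
    have : ((δ.shift i j).a : ℝ) = ((δ'.shift i j).a : ℝ) := by rw [← h.curv, ← h'.curv]
    exact_mod_cast this
  have h0 := key 0 0
  have h1 := key 1 0
  have h2 := key (-1) 0
  have h3 := key 0 1
  simp only [GridData.shift] at h0 h1 h2 h3
  ext <;> omega

theorem IsData.reflectAt {M : Equiv.Perm OrientedCircle} {δ : GridData} (h : IsData M δ)
    (f g : ℤ) : IsData (M * (tilingDual (f, g)).reflect) (δ.reflectAt f g) := by
  intro X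
  rw [Equiv.Perm.mul_apply, h]
  simp only [OrientedCircle.reflect_apply, OrientedCircle.reflectFun,
    OrientedCircle.inversiveProduct, tilingDual, GridData.reflectAt, GridData.dualCurv]
  push_cast
  ring

namespace SquarePacking

variable {A : SquarePacking}

/-- The configurations of a packing share all properties of their data that are stable under the
symmetries of the grid and the inversion in one dual circle. -/
theorem exists_data {δ : GridData} (hδ : IsData A.position δ) {Pr : GridData → Prop}
    (hswap : ∀ δ, Pr δ → Pr δ.swap) (hmirror : ∀ δ, Pr δ → Pr δ.mirror)
    (hstar : ∀ δ, Pr δ → Pr δ.star) (hflip : ∀ δ, Pr δ → Pr δ.flip) (h0 : Pr δ)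
    {h : Equiv.Perm OrientedCircle} (hh : h ∈ tilingGroup) :
    ∃ δ', IsData (A.position * h) δ' ∧ Pr δ' := by
  refine tilingGroup_induction (Pr := fun h => ∃ δ', IsData (A.position * h) δ' ∧ Pr δ')
    ⟨δ, by simpa using hδ, h0⟩ ?_ hh
  rintro h - ⟨δ', h1, h2⟩ f g
  refine ⟨δ'.reflectAt f g, ?_, GridData.reflectAt_of_invariant hswap hmirror hstar hflip δ' h2 f g⟩
  rw [← mul_assoc]
  exact h1.reflectAt f g

/-- The curvatures of the base configuration of an integral packing. -/
theorem IsIntegral.exists_base (hint : A.IsIntegral) : ∃ δ : GridData, IsData A.position δ ∧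
    δ.b ^ 2 + δ.c ^ 2 + δ.e ^ 2 = 2 * δ.e * (δ.b + δ.c) + 4 * δ.e * δ.a ∧
    0 ≤ 2 * δ.a + δ.e := by
  obtain ⟨p, q, r, s, hp, hq, hn, hX⟩ := moebius_curv A.position.2
  have hi : ∀ i j : ℤ, ∃ n : ℤ, p * ((2 * i) ^ 2 + (2 * j) ^ 2 - 1) + q + r * (2 * i) +
      s * (2 * j) = n := by
    intro i j
    obtain ⟨n, hn⟩ := hint (A.base (i, j)) ⟨1, one_mem _, (i, j), rfl⟩
    refine ⟨n, ?_⟩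
    rw [← hn, base, hX]
    simp only [tilingCircle]
    ring
  obtain ⟨n₀, h₀⟩ := hi 0 0
  obtain ⟨n₁, h₁⟩ := hi 1 0
  obtain ⟨n₂, h₂⟩ := hi (-1) 0
  obtain ⟨n₃, h₃⟩ := hi 0 1
  push_cast at h₀ h₁ h₂ h₃
  have hD : (8 * p : ℝ) = ((n₁ + n₂ - 2 * n₀ : ℤ) : ℝ) := by push_cast; linarith
  set D : ℤ := n₁ + n₂ - 2 * n₀
  have hnull : 4 * (n₁ - n₀) ^ 2 + 4 * (n₃ - n₀) ^ 2 + D ^ 2 =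
      4 * D * ((n₁ - n₀) + (n₃ - n₀)) + 8 * D * n₀ := by
    have : (4 * (n₁ - n₀) ^ 2 + 4 * (n₃ - n₀) ^ 2 + D ^ 2 : ℝ) =
        4 * D * ((n₁ - n₀) + (n₃ - n₀)) + 8 * D * n₀ := by
      rw [← hD, ← h₀, ← h₁, ← h₃]
      linear_combination 16 * hn
    exact_mod_cast this
  have heven : Even D := by
    rw [← Int.even_pow' (two_ne_zero)]
    exact ⟨2 * D * ((n₁ - n₀) + (n₃ - n₀)) + 4 * D * n₀ - 2 * (n₁ - n₀) ^ 2 - 2 * (n₃ - n₀) ^ 2,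
      by linear_combination hnull⟩
  obtain ⟨E, hE⟩ := heven
  have hE' : (4 * p : ℝ) = E := by
    have : ((D : ℤ) : ℝ) = E + E := by rw [hE]; push_cast; ring
    linarith
  refine ⟨⟨n₀, n₁ - n₀, n₃ - n₀, E⟩, ?_, ?_, ?_⟩
  · intro X
    rw [hX]
    push_cast
    rw [← hE', ← h₀, ← h₁, ← h₃]
    ring
  · apply mul_left_cancel₀ (four_ne_zero (α := ℤ))
    rw [hE] at hnull
    linear_combination hnull
  · have : (0 : ℝ) ≤ 2 * n₀ + E := by rw [← hE', ← h₀]; linarith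
    exact_mod_cast this

theorem IsTypeOne.isOne (h : A.IsTypeOne) {δ : GridData} (hδ : IsData A.position δ) :
    δ.IsOne := by
  have key : ∀ i j : ℤ, (δ.shift i j).a % 8 = 1 := by
    intro i j
    obtain ⟨n, h1, h2⟩ := h (i, j)
    have h3 := hδ.curv i j
    have h4 : (δ.shift i j).a = n := by
      have : ((δ.shift i j).a : ℝ) = n := by rw [← h3, ← h1]; rfl
      exact_mod_cast this
    rw [h4]
    exact h2
  have h0 := key 0 0
  have h1 := key 1 0
  have h2 := key (-1) 0
  have h3 := key 0 1
  simp only [GridData.shift] at h0 h1 h2 h3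
  rw [GridData.IsOne]
  omega

theorem squareGrid_adj_iff {p q : ℤ × ℤ} (h : squareGrid.Adj p q) :
    q = (p.1 + 1, p.2) ∨ q = (p.1 - 1, p.2) ∨ q = (p.1, p.2 + 1) ∨ q = (p.1, p.2 - 1) := by
  obtain ⟨p1, p2⟩ := p
  obtain ⟨q1, q2⟩ := q
  have h' : |p1 - q1| + |p2 - q2| = 1 := h
  simp only [Prod.mk.injEq]
  rcases abs_cases (p1 - q1) with ⟨h1, _⟩ | ⟨h1, _⟩ <;>
    rcases abs_cases (p2 - q2) with ⟨h2, _⟩ | ⟨h2, _⟩ <;> omega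

theorem squareGrid_adj_opposite {p q : ℤ × ℤ} (h : squareGrid.Adj p q) :
    squareGrid.Adj p (2 * p.1 - q.1, 2 * p.2 - q.2) := by
  have h' : |p.1 - q.1| + |p.2 - q.2| = 1 := h
  change |p.1 - (2 * p.1 - q.1)| + |p.2 - (2 * p.2 - q.2)| = 1
  rw [← h', show p.1 - (2 * p.1 - q.1) = -(p.1 - q.1) by ring,
    show p.2 - (2 * p.2 - q.2) = -(p.2 - q.2) by ring, abs_neg, abs_neg]

theorem IsFullType.isFull (h : A.IsFullType) {δ : GridData} (hδ : IsData A.position δ) :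
    δ.IsFull := by
  obtain ⟨σ, h⟩ := h
  have key : ∀ i j m : ℤ, fullPattern (Fin.ofNat 4 (j % 4).toNat) (Fin.ofNat 8 (i % 8).toNat) =
      (m : ZMod 8) → (δ.shift (σ (i, j)).1 (σ (i, j)).2).a % 8 = m % 8 := by
    intro i j m hm
    obtain ⟨n, h1, h2⟩ := h i j
    have h3 := hδ.curv (σ (i, j)).1 (σ (i, j)).2
    have h4 : (δ.shift (σ (i, j)).1 (σ (i, j)).2).a = n := by
      have : ((δ.shift (σ (i, j)).1 (σ (i, j)).2).a : ℝ) = n := by rw [← h3, ← h1]; rfl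
      exact_mod_cast this
    rw [h4]
    rw [hm] at h2
    exact (ZMod.intCast_eq_intCast_iff n m 8).1 h2
  have k0 := key 0 0 1 (by decide)
  have k1 := key 1 0 3 (by decide)
  have k2 := key (-1) 0 1 (by decide)
  have k3 := key 0 1 0 (by decide)
  have k4 := key 0 (-1) 4 (by decide)
  have adj : ∀ p : ℤ × ℤ, squareGrid.Adj (0, 0) p → squareGrid.Adj (σ (0, 0)) (σ p) :=
    fun p hp => σ.map_rel_iff.2 hp
  have a1 := adj (1, 0) (by change |(0 : ℤ) - 1| + |(0 : ℤ) - 0| = 1; decide)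
  have a3 := adj (0, 1) (by change |(0 : ℤ) - 0| + |(0 : ℤ) - 1| = 1; decide)
  -- the circle opposite to the image of the circle `(1, 0)` is the image of a neighbour of `(0, 0)`
  obtain ⟨w, hw⟩ := σ.surjective (2 * (σ (0, 0)).1 - (σ (1, 0)).1, 2 * (σ (0, 0)).2 - (σ (1, 0)).2)
  have aw : squareGrid.Adj (0, 0) w := by
    apply σ.map_rel_iff.1
    rw [hw]
    exact squareGrid_adj_opposite a1
  have hwne : w ≠ (1, 0) := by
    rintro rfl
    have h1 := congrArg Prod.fst hw
    have h2 := congrArg Prod.snd hw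
    simp only at h1 h2
    apply a1.ne
    ext <;> omega
  have kw : (δ.shift (2 * (σ (0, 0)).1 - (σ (1, 0)).1) (2 * (σ (0, 0)).2 - (σ (1, 0)).2)).a % 8 = 1 ∨
      (δ.shift (2 * (σ (0, 0)).1 - (σ (1, 0)).1) (2 * (σ (0, 0)).2 - (σ (1, 0)).2)).a % 2 = 0 := by
    rcases squareGrid_adj_iff aw with rfl | rfl | rfl | rfl
    · exact absurd rfl hwne
    · left
      simp only [zero_sub] at hw
      rw [hw] at k2
      exact k2
    · right
      simp only [zero_add] at hw
      rw [hw] at k3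
      simp only at k3
      omega
    · right
      simp only [zero_sub] at hw
      rw [hw] at k4
      simp only at k4
      omega
  rw [GridData.IsFull]
  generalize σ (0, 0) = v at *
  generalize σ (1, 0) = x at *
  generalize σ (0, 1) = y at *
  have right : ∀ i j : ℤ, (δ.shift (i + 1) j).a = (δ.shift i j).a + δ.b + 2 * (δ.e * i) := by
    intro i j; simp only [GridData.shift]; ring
  have left : ∀ i j : ℤ, (δ.shift (i - 1) j).a = (δ.shift i j).a - δ.b - 2 * (δ.e * i) + 2 * δ.e := by
    intro i j; simp only [GridData.shift]; ring
  have up : ∀ i j : ℤ, (δ.shift i (j + 1)).a = (δ.shift i j).a + δ.c + 2 * (δ.e * j) := by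
    intro i j; simp only [GridData.shift]; ring
  have down : ∀ i j : ℤ, (δ.shift i (j - 1)).a = (δ.shift i j).a - δ.c - 2 * (δ.e * j) + 2 * δ.e := by
    intro i j; simp only [GridData.shift]; ring
  have r := right v.1 v.2
  have l := left v.1 v.2
  have u := up v.1 v.2
  have d := down v.1 v.2
  have e1 : 2 * v.1 - (v.1 + 1) = v.1 - 1 := by ring
  have e2 : 2 * v.1 - (v.1 - 1) = v.1 + 1 := by ring
  have e3 : 2 * v.2 - (v.2 + 1) = v.2 - 1 := by ring
  have e4 : 2 * v.2 - (v.2 - 1) = v.2 + 1 := by ring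
  have e5 : 2 * v.1 - v.1 = v.1 := by ring
  have e6 : 2 * v.2 - v.2 = v.2 := by ring
  rcases squareGrid_adj_iff a1 with rfl | rfl | rfl | rfl <;>
    rcases squareGrid_adj_iff a3 with rfl | rfl | rfl | rfl <;>
    simp only [e1, e2, e3, e4, e5, e6] at * <;> omega

/-- The curvatures of the base configuration of a packing as in the theorem. -/
theorem exists_good (hint : A.IsIntegral) (hprim : A.IsPrimitive)
    (htype : A.IsTypeOne ∨ A.IsFullType) : ∃ δ : GridData, IsData A.position δ ∧ δ.Good := by
  obtain ⟨δ, hδ, hnull, hpos⟩ := hint.exists_base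
  have hp : ∀ d, δ.Dvd d → IsUnit d := by
    intro d hd
    apply hprim
    rintro n ⟨C, ⟨g, hg, ⟨i, j⟩, rfl⟩, hC⟩
    obtain ⟨h, hh, e⟩ := A.exists_tilingGroup hg
    obtain ⟨δ', h1, h2⟩ := exists_data hδ (Pr := GridData.Dvd d) (fun _ h => h.swap)
      (fun _ h => h.mirror) (fun _ h => h.star) (fun _ h => h.flip) hd hh
    rw [A.apply_base e, h1.curv] at hC
    have hn : (δ'.shift i j).a = n := by exact_mod_cast hC
    rw [← hn]
    exact (GridData.shift_of_invariant (Pr := GridData.Dvd d) (fun _ h => h.swap)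
      (fun _ h => h.mirror) (fun _ h => h.star) δ' h2 i j).1
  refine ⟨δ, hδ, hnull, lt_of_le_of_ne hpos ?_, hp, ?_⟩
  · intro h0
    have hd : (2 * δ.a + δ.e) ^ 2 = (δ.b - δ.e) ^ 2 + (δ.c - δ.e) ^ 2 + 4 * δ.a ^ 2 := by
      linear_combination -hnull
    rw [← h0] at hd
    have ha : δ.a = 0 := by nlinarith [sq_nonneg (δ.b - δ.e), sq_nonneg (δ.c - δ.e)]
    have hb : δ.b - δ.e = 0 := by nlinarith [sq_nonneg (δ.c - δ.e), sq_nonneg (δ.b - δ.e)]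
    have hc : δ.c - δ.e = 0 := by nlinarith [sq_nonneg (δ.c - δ.e), sq_nonneg (δ.b - δ.e)]
    have h2 : IsUnit (2 : ℤ) := hp 2 ⟨by omega, by omega, by omega, by omega⟩
    rw [Int.isUnit_iff] at h2
    omega
  · rcases htype with h | h
    · exact Or.inl (h.isOne hδ)
    · exact Or.inr (h.isFull hδ)

/-! ### The value of the invariant -/

theorem form_eq (δ : GridData) {M : Equiv.Perm OrientedCircle} (h : IsData M δ) (i j x y : ℤ) :
    formBeta (M (tilingCircle (i, j))).curv (M (tilingCircle (i - 1, j))).curv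
      (M (tilingCircle (i, j + 1))).curv (M (tilingCircle (i + 1, j))).curv
      (M (tilingCircle (i, j - 1))).curv x y = ((δ.shift i j).qForm x y : ℝ) := by
  rw [h.curv, h.curv, h.curv, h.curv, h.curv, formBeta]
  simp only [GridData.shift, GridData.qForm]
  push_cast
  ring

theorem formAlpha_eq (a b c d e x y : ℝ) :
    2 * formAlpha a b c d e x y = formBeta a b c d e x y := by
  simp only [formAlpha, formBeta]; ring

/-- Represented integers are integers represented by the form of the data of some configuration. -/
theorem represents_iff {C : OrientedCircle} {ρ : ℤ}
    (hex : ∀ h ∈ tilingGroup, ∃ δ, IsData (A.position * h) δ) :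
    A.Represents C ρ ↔ ∃ h ∈ tilingGroup, ∃ i j : ℤ,
      C = (A.position * h : Equiv.Perm OrientedCircle) (tilingCircle (i, j)) ∧
      ∃ δ, IsData (A.position * h) δ ∧ (δ.shift i j).Rep ρ := by
  constructor
  · rintro ⟨g, hg, i, j, rfl, x, y, -, hxy, hr⟩
    obtain ⟨h, hh, e⟩ := A.exists_tilingGroup hg
    obtain ⟨δ, hδ⟩ := hex h hh
    simp only [A.apply_base e] at hr ⊢
    refine ⟨h, hh, i, j, rfl, δ, hδ, x, y, Int.isCoprime_iff_gcd_eq_one.2 hxy, ?_⟩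
    rcases hr with ⟨hr, h1⟩ | ⟨hr, h1⟩
    · left
      refine ⟨hr, ?_⟩
      have h2 : (2 * ρ : ℝ) = ((δ.shift i j).qForm x y : ℝ) := by
        rw [h1, formAlpha_eq, form_eq δ hδ]
      exact_mod_cast h2
    · right
      refine ⟨hr, ?_⟩
      rw [form_eq δ hδ] at h1
      exact_mod_cast h1
  · rintro ⟨h, hh, i, j, rfl, δ, hδ, hr⟩
    obtain ⟨g, hg, e⟩ := A.exists_apollonianGroup hh
    have hr' : ∃ x y : ℤ, 0 ≤ y ∧ IsCoprime x y ∧ (Odd (x * y) ∧ 2 * ρ = (δ.shift i j).qForm x y ∨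
        Even (x * y) ∧ ρ = (δ.shift i j).qForm x y) := by
      obtain ⟨x, y, hxy, h1⟩ := hr
      rcases le_total 0 y with hy | hy
      · exact ⟨x, y, hy, hxy, h1⟩
      · refine ⟨-x, -y, by omega, hxy.neg_neg, ?_⟩
        have : (δ.shift i j).qForm (-x) (-y) = (δ.shift i j).qForm x y := by
          simp only [GridData.qForm]; ring
        rwa [this, neg_mul_neg]
    obtain ⟨x, y, hy, hxy, h1⟩ := hr'
    refine ⟨g, hg, i, j, (A.apply_base e _).symm, x, y, hy, Int.isCoprime_iff_gcd_eq_one.1 hxy, ?_⟩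
    simp only [A.apply_base e]
    rcases h1 with ⟨hr, h1⟩ | ⟨hr, h1⟩
    · left
      refine ⟨hr, ?_⟩
      have h2 : (2 * ρ : ℝ) = ((δ.shift i j).qForm x y : ℝ) := by exact_mod_cast h1
      rw [← form_eq δ hδ, ← formAlpha_eq] at h2
      linarith
    · right
      refine ⟨hr, ?_⟩
      rw [form_eq δ hδ]
      exact_mod_cast h1

/-- The values of `χ₂` at a circle come from the data of configurations that contain it. -/
theorem isChiTwoAt_iff {C : OrientedCircle} {ε : ℤ}
    (hex : ∀ h ∈ tilingGroup, ∃ δ, IsData (A.position * h) δ) :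
    A.IsChiTwoAt C ε ↔ ∃ h ∈ tilingGroup, ∃ i j : ℤ,
      C = (A.position * h : Equiv.Perm OrientedCircle) (tilingCircle (i, j)) ∧
      ∃ δ, IsData (A.position * h) δ ∧ (δ.shift i j).HasVal ε := by
  constructor
  · rintro ⟨a, ρ, ha, hr, hc, rfl⟩
    obtain ⟨h, hh, i, j, rfl, δ, hδ, hr⟩ := (represents_iff hex).1 hr
    rw [hδ.curv] at ha
    have ha' : (δ.shift i j).a = a := by exact_mod_cast ha
    rw [← Int.isCoprime_iff_gcd_eq_one] at hc
    exact ⟨h, hh, i, j, rfl, δ, hδ, ρ, hr, ha' ▸ hc, by rw [ha']⟩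
  · rintro ⟨h, hh, i, j, rfl, δ, hδ, ρ, hr, hc, rfl⟩
    exact ⟨_, ρ, hδ.curv i j, (represents_iff hex).2 ⟨h, hh, i, j, rfl, δ, hδ, hr⟩,
      Int.isCoprime_iff_gcd_eq_one.1 hc, rfl⟩

/-- The data of all configurations are good, and share the value of `χ₂`. -/
theorem exists_good_data {δ : GridData} (hδ : IsData A.position δ) (hg : δ.Good) {ε : ℤ}
    (hε : δ.HasVal ε) {h : Equiv.Perm OrientedCircle} (hh : h ∈ tilingGroup) :
    ∃ δ', IsData (A.position * h) δ' ∧ ∀ i j, (δ'.shift i j).Good ∧ (δ'.shift i j).HasVal ε := by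
  have h1 : ∀ δ : GridData, δ.Good ∧ δ.HasVal ε → δ.swap.Good ∧ δ.swap.HasVal ε :=
    fun δ h => ⟨h.1.swap, h.2.swap⟩
  have h2 : ∀ δ : GridData, δ.Good ∧ δ.HasVal ε → δ.mirror.Good ∧ δ.mirror.HasVal ε :=
    fun δ h => ⟨h.1.mirror, h.2.mirror⟩
  have h3 : ∀ δ : GridData, δ.Good ∧ δ.HasVal ε → δ.star.Good ∧ δ.star.HasVal ε :=
    fun δ h => ⟨h.1.star, h.1.hasVal_star h.2⟩
  obtain ⟨δ', h4, h5⟩ := exists_data hδ (Pr := fun δ => δ.Good ∧ δ.HasVal ε) h1 h2 h3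
    (fun δ h => ⟨h.1.flip, h.2.flip⟩) ⟨hg, hε⟩ hh
  exact ⟨δ', h4, fun i j => GridData.shift_of_invariant
    (Pr := fun δ => δ.Good ∧ δ.HasVal ε) h1 h2 h3 δ' h5 i j⟩

theorem hasChiTwo_of_hasVal {δ : GridData} (hδ : IsData A.position δ) (hg : δ.Good) {ε : ℤ}
    (hε : δ.HasVal ε) : A.HasChiTwo ε := by
  have hall := fun h hh => exists_good_data (A := A) hδ hg hε (h := h) hh
  have hex : ∀ h ∈ tilingGroup, ∃ δ, IsData (A.position * h) δ :=
    fun h hh => (hall h hh).imp fun _ h => h.1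
  rintro C ⟨g, hgA, ⟨i, j⟩, rfl⟩ ε'
  rw [isChiTwoAt_iff hex]
  constructor
  · rintro ⟨h, hh, k, l, -, δ', hδ', hv⟩
    obtain ⟨δ'', h1, h2⟩ := hall h hh
    obtain rfl := h1.unique hδ'
    exact (h2 k l).1.hasVal_unique hv (h2 k l).2
  · rintro rfl
    obtain ⟨h, hh, e⟩ := A.exists_tilingGroup hgA
    obtain ⟨δ', h1, h2⟩ := hall h hh
    exact ⟨h, hh, i, j, A.apply_base e _, δ', h1, (h2 i j).2⟩

theorem sq_notMem_curvatures {δ : GridData} (hδ : IsData A.position δ) (hg : δ.Good)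
    (hε : δ.HasVal (-1)) (n : ℤ) : n ^ 2 ∉ A.curvatures := by
  rintro ⟨C, ⟨g, hgA, ⟨i, j⟩, rfl⟩, hC⟩
  obtain ⟨h, hh, e⟩ := A.exists_tilingGroup hgA
  obtain ⟨δ', h1, h2⟩ := exists_good_data hδ hg hε hh
  rw [A.apply_base e, h1.curv] at hC
  have hn : (δ'.shift i j).a = n ^ 2 := by exact_mod_cast hC
  have := GridData.Good.hasVal_of_sq (h2 i j).1 hn (h2 i j).2
  omega

end SquarePacking

/-! ### Local solubility -/

/-- Hensel lifting of a simple root of a quadratic polynomial. -/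
theorem exists_pow_dvd_quadratic {p : ℕ} (hp : p.Prime) {α β γ t₀ : ℤ}
    (h0 : (p : ℤ) ∣ α * t₀ ^ 2 + β * t₀ + γ) (hd : ¬ (p : ℤ) ∣ 2 * α * t₀ + β) (k : ℕ) :
    ∃ t, (p : ℤ) ^ k ∣ α * t ^ 2 + β * t + γ := by
  suffices h : ∀ k : ℕ, ∃ t, (p : ℤ) ^ (k + 1) ∣ α * t ^ 2 + β * t + γ ∧ (p : ℤ) ∣ t - t₀ by
    obtain ⟨t, ht, -⟩ := h k
    exact ⟨t, (pow_dvd_pow _ (Nat.le_succ k)).trans ht⟩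
  intro k
  induction k with
  | zero => exact ⟨t₀, by simpa using h0, by simp⟩
  | succ k ih =>
    obtain ⟨t, ⟨r, hr⟩, ht⟩ := ih
    have hd' : ¬ (p : ℤ) ∣ 2 * α * t + β := by
      intro h
      apply hd
      have := h.sub (ht.mul_left (2 * α))
      exact this.trans_eq (by ring)
    have hcop : IsCoprime (p : ℤ) (2 * α * t + β) :=
      ((Nat.prime_iff_prime_int.1 hp).coprime_iff_not_dvd).2 hd'
    obtain ⟨u, v, huv⟩ := hcop
    refine ⟨t - (p : ℤ) ^ (k + 1) * (v * r), ?_, ?_⟩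
    · refine ⟨u * r + α * (p : ℤ) ^ k * (v * r) ^ 2, ?_⟩
      have e : α * (t - (p : ℤ) ^ (k + 1) * (v * r)) ^ 2 + β * (t - (p : ℤ) ^ (k + 1) * (v * r)) + γ =
          (α * t ^ 2 + β * t + γ) - (p : ℤ) ^ (k + 1) * (v * (2 * α * t + β)) * r +
          α * ((p : ℤ) ^ (k + 1)) ^ 2 * (v * r) ^ 2 := by ring
      rw [e, hr, show v * (2 * α * t + β) = 1 - u * p by linear_combination huv]
      ring
    · have h1 : (p : ℤ) ∣ (p : ℤ) ^ (k + 1) * (v * r) :=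
        (dvd_pow_self _ (Nat.succ_ne_zero k)).mul_right _
      have := ht.sub h1
      exact this.trans_eq (by ring)

/-- Solutions modulo prime powers can be combined. -/
theorem exists_dvd_of_forall_prime_pow (F : ℤ → ℤ → ℤ)
    (hF : ∀ d i j i' j' : ℤ, d ∣ i - i' → d ∣ j - j' → d ∣ F i j - F i' j') (m : ℕ)
    (hm : m ≠ 0) (h : ∀ p : ℕ, p.Prime → p ∣ m → ∀ k : ℕ, ∃ i j, (p : ℤ) ^ k ∣ F i j) :
    ∃ i j, (m : ℤ) ∣ F i j := by
  induction m using Nat.recOnPosPrimePosCoprime with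
  | prime_pow p k hp hk =>
    obtain ⟨i, j, hij⟩ := h p hp (dvd_pow_self _ hk.ne') k
    exact ⟨i, j, by exact_mod_cast hij⟩
  | zero => exact absurd rfl hm
  | one => exact ⟨0, 0, by simp⟩
  | coprime a b ha hb hab iha ihb =>
    obtain ⟨i, j, h1⟩ := iha (by omega) fun p hp hpa => h p hp (hpa.mul_right b)
    obtain ⟨i', j', h2⟩ := ihb (by omega) fun p hp hpb => h p hp (hpb.mul_left a)
    have hcop : IsCoprime (a : ℤ) (b : ℤ) := Nat.isCoprime_iff_coprime.2 hab
    obtain ⟨u, v, huv⟩ := hcop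
    refine ⟨i * (v * b) + i' * (u * a), j * (v * b) + j' * (u * a), ?_⟩
    push_cast
    refine IsCoprime.mul_dvd ⟨u, v, huv⟩ ?_ ?_
    · have := (hF a (i * (v * b) + i' * (u * a)) (j * (v * b) + j' * (u * a)) i j
        ⟨(i' - i) * u, by linear_combination i * huv⟩
        ⟨(j' - j) * u, by linear_combination j * huv⟩).add h1
      exact this.trans_eq (by ring)
    · have := (hF b (i * (v * b) + i' * (u * a)) (j * (v * b) + j' * (u * a)) i' j'
        ⟨(i - i') * v, by linear_combination i' * huv⟩
        ⟨(j - j') * v, by linear_combination j' * huv⟩).add h2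
      exact this.trans_eq (by ring)

namespace GridData

theorem Good.reflectAt {δ : GridData} (h : Good δ) (f g : ℤ) : Good (δ.reflectAt f g) :=
  reflectAt_of_invariant (fun _ h => h.swap) (fun _ h => h.mirror) (fun _ h => h.star)
    (fun _ h => h.flip) δ h f g

theorem reflectAt_e (δ : GridData) (f : ℤ) : (δ.reflectAt f 0).e =
    4 * δ.e * f ^ 2 + 4 * δ.b * f + (4 * δ.a + 2 * δ.b + 2 * δ.c - δ.e) := by
  simp only [GridData.reflectAt, dualCurv]; ring

/-- The configurations after one inversion include one whose leading coefficient avoids the classes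
`0` and `-4 n²` modulo a given odd prime. -/
theorem Good.exists_reflectAt_prime {δ : GridData} (h : Good δ) {n : ℤ} (h3n : 3 ∣ n) {p : ℕ}
    (hp : p.Prime) (h2 : p ≠ 2) (hen : (p : ℤ) ∣ δ.e → (p : ℤ) ∣ n) :
    ∃ f : ℕ, ¬ (p : ℤ) ∣ (δ.reflectAt f 0).e * ((δ.reflectAt f 0).e + 4 * n ^ 2) := by
  have hp' := Nat.prime_iff_prime_int.1 hp
  have hn2 := hp.not_dvd_two_of_ne h2
  have cancel : ∀ x : ℤ, (p : ℤ) ∣ 2 * x → (p : ℤ) ∣ x := fun x hx =>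
    (hp'.dvd_or_dvd hx).resolve_left hn2
  by_contra! hall
  by_cases hpn : (p : ℤ) ∣ n
  · have hall' : ∀ f : ℕ, (p : ℤ) ∣ (δ.reflectAt f 0).e := by
      intro f
      rcases hp'.dvd_or_dvd (hall f) with h1 | h1
      · exact h1
      · have := h1.sub ((hpn.mul_left n).mul_left 4)
        exact this.trans_eq (by ring)
    have h0 := hall' 0
    have h1 := hall' 1
    have h3 := hall' 2
    rw [reflectAt_e] at h0 h1 h3
    push_cast at h0 h1 h3
    have he : (p : ℤ) ∣ δ.e := by
      apply cancel; apply cancel; apply cancel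
      exact ((h0.add h3).sub (h1.mul_left 2)).trans_eq (by ring)
    have hb : (p : ℤ) ∣ δ.b := by
      apply cancel; apply cancel
      exact ((h1.sub h0).sub (he.mul_left 4)).trans_eq (by ring)
    have hc : (p : ℤ) ∣ δ.c := by
      apply hp'.dvd_of_dvd_pow (n := 2)
      have := ((he.mul_left (2 * (δ.b + δ.c) + 4 * δ.a - δ.e)).sub (hb.mul_left δ.b))
      exact this.trans_eq (by linear_combination -h.null)
    have ha : (p : ℤ) ∣ δ.a := by
      apply cancel; apply cancel
      exact (((h0.sub (hb.mul_left 2)).sub (hc.mul_left 2)).add he).trans_eq (by ring)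
    exact hp'.not_isUnit (h.prim p ⟨ha, hb, hc, he⟩)
  · have hpe : ¬ (p : ℤ) ∣ δ.e := fun h => hpn (hen h)
    have h0 := hall 0
    have h1 := hall 1
    have h3 := hall 2
    have h4 := hall 3
    have h5 := hall 4
    rw [reflectAt_e] at h0 h1 h3 h4 h5
    push_cast at h0 h1 h3 h4 h5
    -- the fourth finite difference of this polynomial of degree `4` is `24 (4 e)²`
    have h6 : (p : ℤ) ∣ 2 * (2 * (2 * (2 * (2 * (2 * (2 * (3 * δ.e ^ 2))))))) :=
      (((((h3.mul_left 6).sub (h1.mul_left 4)).sub (h4.mul_left 4)).add h0).add h5).trans_eq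
        (by ring)
    have h7 : (p : ℤ) ∣ 3 * δ.e ^ 2 :=
      cancel _ (cancel _ (cancel _ (cancel _ (cancel _ (cancel _ (cancel _ h6))))))
    rcases hp'.dvd_or_dvd h7 with h8 | h8
    · exact hpn (h8.trans h3n)
    · exact hpe (hp'.dvd_of_dvd_pow h8)

theorem Good.exists_reflectAt {δ : GridData} (h : Good δ) {n : ℤ} (h3n : 3 ∣ n)
    (hen : ∀ p : ℕ, p.Prime → p ≠ 2 → (p : ℤ) ∣ δ.e → (p : ℤ) ∣ n) {m : ℕ} (hm : m ≠ 0) :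
    ∃ f : ℤ, ∀ p : ℕ, p.Prime → p ∣ m → p ≠ 2 →
      ¬ (p : ℤ) ∣ (δ.reflectAt f 0).e * ((δ.reflectAt f 0).e + 4 * n ^ 2) := by
  have hmod : ∀ p f f' : ℕ, f ≡ f' [MOD p] →
      (p : ℤ) ∣ (δ.reflectAt f' 0).e - (δ.reflectAt f 0).e := by
    intro p f f' hff
    have h1 : (p : ℤ) ∣ (f' : ℤ) - f := Nat.modEq_iff_dvd.1 hff
    rw [reflectAt_e, reflectAt_e]
    exact (h1.mul_left (4 * δ.e * (f' + f) + 4 * δ.b)).trans_eq (by ring)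
  have key := exists_nat_forall_prime_dvd (N := m) (Int.natCast_ne_zero.2 hm)
    (fun p f => p ≠ 2 →
      ¬ (p : ℤ) ∣ (δ.reflectAt f 0).e * ((δ.reflectAt f 0).e + 4 * n ^ 2))
    (fun p f f' _ hff h1 h2 h3 => by
      have h4 := (hmod p f f' hff).mul_left
        ((δ.reflectAt f' 0).e + (δ.reflectAt f 0).e + 4 * n ^ 2)
      exact h1 h2 ((h3.sub h4).trans_eq (by ring)))
    (fun p hp _ => by
      by_cases h2 : p = 2
      · exact ⟨0, fun h => absurd h2 h⟩
      · obtain ⟨f, hf⟩ := h.exists_reflectAt_prime h3n hp h2 (hen p hp h2)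
        exact ⟨f, fun _ => hf⟩)
  obtain ⟨f, hf⟩ := key
  exact ⟨f, fun p hp hpm => hf p hp (Int.natCast_dvd_natCast.2 hpm)⟩

/-- Lifting in the horizontal direction. -/
theorem exists_pow_dvd_horizontal (δ : GridData) {p : ℕ} (hp : p.Prime) {n i j : ℤ}
    (h0 : (p : ℤ) ∣ (δ.shift i j).a - n) (hd : ¬ (p : ℤ) ∣ 2 * δ.e * i + (δ.b - δ.e)) (k : ℕ) :
    ∃ i j, (p : ℤ) ^ k ∣ (δ.shift i j).a - n := by
  obtain ⟨t, ht⟩ := exists_pow_dvd_quadratic hp (α := δ.e) (β := δ.b - δ.e)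
    (γ := δ.a + δ.c * j + δ.e * (j ^ 2 - j) - n) (t₀ := i)
    (h0.trans_eq (by simp only [shift]; ring)) hd k
  exact ⟨t, j, ht.trans_eq (by simp only [shift]; ring)⟩

/-- Lifting in the vertical direction. -/
theorem exists_pow_dvd_vertical (δ : GridData) {p : ℕ} (hp : p.Prime) {n i j : ℤ}
    (h0 : (p : ℤ) ∣ (δ.shift i j).a - n) (hd : ¬ (p : ℤ) ∣ 2 * δ.e * j + (δ.c - δ.e)) (k : ℕ) :
    ∃ i j, (p : ℤ) ^ k ∣ (δ.shift i j).a - n := by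
  obtain ⟨t, ht⟩ := exists_pow_dvd_quadratic hp (α := δ.e) (β := δ.c - δ.e)
    (γ := δ.a + δ.b * i + δ.e * (i ^ 2 - i) - n) (t₀ := j)
    (h0.trans_eq (by simp only [shift]; ring)) hd k
  exact ⟨i, t, ht.trans_eq (by simp only [shift]; ring)⟩

/-- Solubility at odd primes: completing squares, the equation becomes
`X² + Y² = e (e + 4 n)`. -/
theorem Good.exists_pow_dvd_odd {δ : GridData} (h : Good δ) {p : ℕ} (hp : p.Prime) (h2 : p ≠ 2)
    {n : ℤ} (hn : ¬ (p : ℤ) ∣ δ.e * (δ.e + 4 * n)) (k : ℕ) :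
    ∃ i j, (p : ℤ) ^ k ∣ (δ.shift i j).a - n := by
  have := Fact.mk hp
  have hp' := Nat.prime_iff_prime_int.1 hp
  have hn2 := hp.not_dvd_two_of_ne h2
  have he : ¬ (p : ℤ) ∣ δ.e := fun h => hn (h.mul_right _)
  have h2e : ((2 * δ.e : ℤ) : ZMod p) ≠ 0 := by
    rw [Ne, ZMod.intCast_zmod_eq_zero_iff_dvd]
    intro h
    rcases hp'.dvd_or_dvd h with h | h
    · exact hn2 h
    · exact he h
  obtain ⟨x, y, hxy⟩ := ZMod.sq_add_sq p ((δ.e * (δ.e + 4 * n) : ℤ) : ZMod p)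
  obtain ⟨i, hi⟩ := ZMod.intCast_surjective ((x - ((δ.b - δ.e : ℤ) : ZMod p)) / ((2 * δ.e : ℤ) : ZMod p))
  obtain ⟨j, hj⟩ := ZMod.intCast_surjective ((y - ((δ.c - δ.e : ℤ) : ZMod p)) / ((2 * δ.e : ℤ) : ZMod p))
  have hx : ((2 * δ.e * i + (δ.b - δ.e) : ℤ) : ZMod p) = x := by
    rw [Int.cast_add, Int.cast_mul, hi, mul_div_cancel₀ _ h2e]; ring
  have hy : ((2 * δ.e * j + (δ.c - δ.e) : ℤ) : ZMod p) = y := by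
    rw [Int.cast_add, Int.cast_mul, hj, mul_div_cancel₀ _ h2e]; ring
  have h0 : (p : ℤ) ∣ (δ.shift i j).a - n := by
    have h3 : (p : ℤ) ∣ (2 * δ.e * i + (δ.b - δ.e)) ^ 2 + (2 * δ.e * j + (δ.c - δ.e)) ^ 2 -
        δ.e * (δ.e + 4 * n) := by
      rw [← ZMod.intCast_zmod_eq_zero_iff_dvd, Int.cast_sub, Int.cast_add, Int.cast_pow,
        Int.cast_pow, hx, hy, hxy, sub_self]
    have h4 : (p : ℤ) ∣ (2 * δ.e) * (2 * ((δ.shift i j).a - n)) :=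
      h3.trans_eq (by simp only [shift]; linear_combination h.null)
    rcases hp'.dvd_or_dvd h4 with h5 | h5
    · exact absurd ((ZMod.intCast_zmod_eq_zero_iff_dvd _ _).2 h5) h2e
    · exact (hp'.dvd_or_dvd h5).resolve_left hn2
  by_cases hx0 : x = 0
  · have hy0 : y ≠ 0 := by
      rintro rfl
      rw [hx0] at hxy
      apply hn
      rw [← ZMod.intCast_zmod_eq_zero_iff_dvd, ← hxy]
      ring
    refine δ.exists_pow_dvd_vertical hp h0 ?_ k
    rwa [← ZMod.intCast_zmod_eq_zero_iff_dvd, hy]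
  · refine δ.exists_pow_dvd_horizontal hp h0 ?_ k
    rwa [← ZMod.intCast_zmod_eq_zero_iff_dvd, hx]

/-- Solubility at `2` for full type. -/
theorem IsFull.exists_two_pow_dvd {δ : GridData} (h : IsFull δ) (n : ℤ) (k : ℕ) :
    ∃ i j, ((2 : ℕ) : ℤ) ^ k ∣ (δ.shift i j).a - n := by
  rw [IsFull] at h
  have step : ∀ x : ℤ, Even (x ^ 2 - x) := fun x => by
    have := Int.even_mul_pred_self x
    rwa [mul_sub, mul_one, ← sq] at this
  obtain ⟨r, hr⟩ := step (δ.a - n)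
  obtain ⟨b, hb⟩ | ⟨c, hc⟩ : (∃ b, δ.b = 2 * b + 1) ∨ ∃ c, δ.c = 2 * c + 1 := by
    rcases Int.emod_two_eq_zero_or_one δ.b with hb | hb
    · exact Or.inr ⟨δ.c / 2, by omega⟩
    · exact Or.inl ⟨δ.b / 2, by omega⟩
  · refine δ.exists_pow_dvd_vertical Nat.prime_two (i := δ.a - n) (j := 0) ?_ ?_ k
    · refine ⟨(δ.a - n) + b * (δ.a - n) + δ.e * r, ?_⟩
      simp only [shift]
      push_cast
      linear_combination (δ.a - n) * hb + δ.e * hr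
    · push_cast
      omega
  · refine δ.exists_pow_dvd_horizontal Nat.prime_two (i := 0) (j := δ.a - n) ?_ ?_ k
    · refine ⟨(δ.a - n) + c * (δ.a - n) + δ.e * r, ?_⟩
      simp only [shift]
      push_cast
      linear_combination (δ.a - n) * hc + δ.e * hr
    · push_cast
      omega

/-- Solubility at `2` for type `(1)`: triangular numbers fill all residue classes modulo powers of
`2`. -/
theorem IsOne.exists_two_pow_dvd {δ : GridData} (h : IsOne δ) (he : δ.e % 16 = 4) {n : ℤ}
    (hn : n % 8 = 1) (k : ℕ) : ∃ i j, ((2 : ℕ) : ℤ) ^ k ∣ (δ.shift i j).a - n := by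
  rw [IsOne] at h
  obtain ⟨γ, hγ⟩ : ∃ γ, δ.a - n = 8 * γ := ⟨(δ.a - n) / 8, by omega⟩
  obtain ⟨b, hb⟩ : ∃ b, δ.b = 8 * b := ⟨δ.b / 8, by omega⟩
  obtain ⟨e, he'⟩ : ∃ e, δ.e = 4 * (2 * e + 1) := ⟨(δ.e / 4) / 2, by omega⟩
  obtain ⟨t, ht⟩ := exists_pow_dvd_quadratic Nat.prime_two (α := 2 * (2 * e + 1))
    (β := 2 * b - (2 * e + 1)) (γ := γ) (t₀ := γ)
    ⟨(2 * e + 1) * γ ^ 2 + b * γ - e * γ, by push_cast; ring⟩ (by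
      push_cast
      have : 2 * (2 * (2 * e + 1)) * γ + (2 * b - (2 * e + 1)) =
        2 * ((2 * (2 * e + 1)) * γ + b - e - 1) + 1 := by ring
      omega) k
  refine ⟨2 * t, 0, (ht.mul_left 8).trans_eq ?_⟩
  simp only [shift, hb, he']
  linear_combination -hγ

theorem IsOne.reflectAt_e_emod {δ : GridData} (h : IsOne δ) (f : ℤ) :
    (δ.reflectAt f 0).e % 16 = (4 - δ.e) % 16 := by
  rw [IsOne] at h
  obtain ⟨a, ha⟩ : ∃ a, δ.a = 8 * a + 1 := ⟨δ.a / 8, by omega⟩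
  obtain ⟨b, hb⟩ : ∃ b, δ.b = 8 * b := ⟨δ.b / 8, by omega⟩
  obtain ⟨c, hc⟩ : ∃ c, δ.c = 8 * c := ⟨δ.c / 8, by omega⟩
  obtain ⟨e, he⟩ : ∃ e, δ.e = 4 * e := ⟨δ.e / 4, by omega⟩
  have : (δ.reflectAt f 0).e = 4 - δ.e + 16 * (e * f ^ 2 + 2 * b * f + 2 * a + b + c) := by
    rw [reflectAt_e, ha, hb, hc, he]; ring
  omega

theorem Good.e_emod_of_isOne {δ : GridData} (h : Good δ) (h1 : IsOne δ) :
    δ.e % 16 = 0 ∨ δ.e % 16 = 4 := by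
  have hn := h.null
  rw [IsOne] at h1
  obtain ⟨a, ha⟩ : ∃ a, δ.a = 8 * a + 1 := ⟨δ.a / 8, by omega⟩
  obtain ⟨b, hb⟩ : ∃ b, δ.b = 8 * b := ⟨δ.b / 8, by omega⟩
  obtain ⟨c, hc⟩ : ∃ c, δ.c = 8 * c := ⟨δ.c / 8, by omega⟩
  obtain ⟨e, he⟩ : ∃ e, δ.e = 4 * e := ⟨δ.e / 4, by omega⟩
  rw [ha, hb, hc, he] at hn
  have key : e * (e - 1) = 4 * (e * (b + c) + 2 * e * a - b ^ 2 - c ^ 2) := by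
    apply mul_left_cancel₀ (show (16 : ℤ) ≠ 0 by norm_num)
    linear_combination hn
  obtain ⟨t, ht⟩ : ∃ t, e = 4 * t + e % 4 := ⟨e / 4, by omega⟩
  have h4 : e % 4 = 0 ∨ e % 4 = 1 ∨ e % 4 = 2 ∨ e % 4 = 3 := by omega
  have hee : e * (e - 1) = 4 * (4 * t ^ 2 + t * (2 * (e % 4) - 1)) + (e % 4) * (e % 4 - 1) := by
    nth_rewrite 1 2 [ht]; ring
  rcases h4 with h4 | h4 | h4 | h4 <;> rw [h4] at hee <;> omega

theorem Good.isOne_reflectAt {δ : GridData} (h : Good δ) (h1 : IsOne δ) (f : ℤ) :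
    IsOne (δ.reflectAt f 0) := by
  have h2 := h1.reflectAt_e_emod f
  have h3 := (h.reflectAt f 0).type
  simp only [IsOne, IsFull] at h1 h3 ⊢
  omega

theorem Good.isFull_reflectAt {δ : GridData} (h : Good δ) (h1 : IsFull δ) (f : ℤ) :
    IsFull (δ.reflectAt f 0) := by
  have h3 := (h.reflectAt f 0).type
  have h4 : (δ.reflectAt f 0).e % 2 = δ.e % 2 := by
    rw [reflectAt_e]
    have : 4 * δ.e * f ^ 2 + 4 * δ.b * f + (4 * δ.a + 2 * δ.b + 2 * δ.c - δ.e) =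
      -δ.e + 2 * (2 * δ.e * f ^ 2 + 2 * δ.b * f + 2 * δ.a + δ.b + δ.c) := by ring
    omega
  simp only [IsOne, IsFull] at h1 h3 ⊢
  omega

theorem dvd_shift_sub (δ : GridData) {d i j i' j' : ℤ} (hi : d ∣ i - i') (hj : d ∣ j - j') (n : ℤ) :
    d ∣ ((δ.shift i j).a - n) - ((δ.shift i' j').a - n) := by
  have := (hi.mul_left (δ.b + δ.e * (i + i' - 1))).add (hj.mul_left (δ.c + δ.e * (j + j' - 1)))
  exact this.trans_eq (by simp only [shift]; ring)

/-- Certain odd squares are curvatures modulo every integer. -/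
theorem Good.exists_dvd {δ : GridData} (h : Good δ) (ht : IsOne δ ∧ δ.e % 16 = 0 ∨ IsFull δ) {n : ℤ}
    (h3n : 3 ∣ n) (hodd : Odd n)
    (hen : ∀ p : ℕ, p.Prime → p ≠ 2 → (p : ℤ) ∣ δ.e → (p : ℤ) ∣ n) {m : ℕ} (hm : m ≠ 0) :
    ∃ f i j, (m : ℤ) ∣ ((δ.reflectAt f 0).shift i j).a - n ^ 2 := by
  obtain ⟨f, hf⟩ := h.exists_reflectAt h3n hen hm
  refine ⟨f, exists_dvd_of_forall_prime_pow
    (fun i j => ((δ.reflectAt f 0).shift i j).a - n ^ 2) ?_ m hm ?_⟩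
  · intro d i j i' j' hi hj
    exact dvd_shift_sub _ hi hj _
  · intro p hp hpm k
    by_cases h2 : p = 2
    · subst h2
      rcases ht with ⟨h1, he⟩ | h1
      · have h8 := Int.eight_dvd_sq_sub_one_of_odd hodd
        have h3 := h1.reflectAt_e_emod f
        exact (h.isOne_reflectAt h1 f).exists_two_pow_dvd (by omega) (by omega) k
      · exact (h.isFull_reflectAt h1 f).exists_two_pow_dvd _ k
    · exact (h.reflectAt f 0).exists_pow_dvd_odd hp h2 (hf p hp hpm h2) k

end GridData

namespace SquarePacking

variable {A : SquarePacking}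

/-- `δ` is the data of some configuration of the packing. -/
def IsConfig (A : SquarePacking) (δ : GridData) : Prop :=
  ∃ h ∈ tilingGroup, IsData (A.position * h) δ

theorem IsConfig.reflectAt {δ : GridData} (h : A.IsConfig δ) (f g : ℤ) :
    A.IsConfig (δ.reflectAt f g) := by
  obtain ⟨h, hh, hδ⟩ := h
  refine ⟨_, mul_mem hh (reflect_mem_tilingGroup f g), ?_⟩
  rw [← mul_assoc]
  exact hδ.reflectAt f g

theorem IsConfig.mem_curvatures {δ : GridData} (h : A.IsConfig δ) (i j : ℤ) :
    (δ.shift i j).a ∈ A.curvatures := by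
  obtain ⟨h, hh, hδ⟩ := h
  obtain ⟨g, hg, e⟩ := A.exists_apollonianGroup hh
  exact ⟨_, ⟨g, hg, (i, j), rfl⟩, by rw [A.apply_base e, hδ.curv]⟩

/-- In type `(1)` there is a configuration whose leading coefficient is divisible by `16`, and not
zero. -/
theorem IsConfig.exists_of_isOne {δ : GridData} (h : A.IsConfig δ) (hg : δ.Good) (h1 : δ.IsOne) :
    ∃ δ', A.IsConfig δ' ∧ δ'.Good ∧ δ'.IsOne ∧ δ'.e % 16 = 0 ∧ δ'.e ≠ 0 := by
  have step : ∀ δ : GridData, A.IsConfig δ → δ.Good → δ.IsOne → δ.e % 16 = 4 →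
      ∃ δ', A.IsConfig δ' ∧ δ'.Good ∧ δ'.IsOne ∧ δ'.e % 16 = 0 ∧ δ'.e ≠ 0 := by
    intro δ h hg h1 he
    have hf : ∃ f, (δ.reflectAt f 0).e ≠ 0 := by
      by_contra! hall
      have h0 := hall 0
      have h2 := hall 1
      have h3 := hall (-1)
      rw [GridData.reflectAt_e] at h0 h2 h3
      omega
    obtain ⟨f, hf⟩ := hf
    have := h1.reflectAt_e_emod f
    exact ⟨_, h.reflectAt f 0, hg.reflectAt f 0, hg.isOne_reflectAt h1 f, by omega, hf⟩
  rcases hg.e_emod_of_isOne h1 with he | he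
  · by_cases h0 : δ.e = 0
    · have := h1.reflectAt_e_emod 0
      exact step _ (h.reflectAt 0 0) (hg.reflectAt 0 0) (hg.isOne_reflectAt h1 0) (by omega)
    · exact ⟨δ, h, hg, h1, he, h0⟩
  · exact step δ h hg h1 he

/-- Arbitrarily large squares satisfy the modular restrictions. -/
theorem IsConfig.exists_sq_isAdmissible {δ : GridData} (h : A.IsConfig δ) (hg : δ.Good) (N : ℤ) :
    ∃ n : ℤ, N ≤ n ^ 2 ∧ A.IsAdmissible (n ^ 2) := by
  obtain ⟨δ', h', hg', ht, he⟩ : ∃ δ', A.IsConfig δ' ∧ δ'.Good ∧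
      (δ'.IsOne ∧ δ'.e % 16 = 0 ∨ δ'.IsFull) ∧ δ'.e ≠ 0 := by
    rcases hg.type with h1 | h1
    · obtain ⟨δ', h2, h3, h4, h5, h6⟩ := h.exists_of_isOne hg h1
      exact ⟨δ', h2, h3, Or.inl ⟨h4, h5⟩, h6⟩
    · refine ⟨δ, h, hg, Or.inr h1, ?_⟩
      have := h1.1
      omega
  obtain ⟨v, u, hu, heu⟩ := Int.exists_eq_two_pow_mul_odd he
  have hu0 : u ≠ 0 := by
    rintro rfl
    simp at hu
  refine ⟨3 * (u * (2 * |N| + 1)), ?_, ?_⟩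
  · have h1 : N ≤ |N| := le_abs_self N
    have h2 : 0 ≤ |N| := abs_nonneg N
    have h3 : 1 ≤ u ^ 2 := Int.one_le_abs (pow_ne_zero 2 hu0) |>.trans_eq (abs_of_nonneg (sq_nonneg u))
    have h4 : (3 * (u * (2 * |N| + 1))) ^ 2 = 9 * (u ^ 2 * (2 * |N| + 1) ^ 2) := by ring
    have h5 : (2 * |N| + 1) ^ 2 ≤ u ^ 2 * (2 * |N| + 1) ^ 2 :=
      le_mul_of_one_le_left (sq_nonneg _) h3
    nlinarith
  · intro m hm
    have hodd : Odd (3 * (u * (2 * |N| + 1))) :=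
      (by decide : Odd (3 : ℤ)).mul (hu.mul ⟨|N|, rfl⟩)
    obtain ⟨f, i, j, hd⟩ := hg'.exists_dvd ht (dvd_mul_right 3 _) hodd (by
      intro p hp h2 hpe
      have hp' := Nat.prime_iff_prime_int.1 hp
      rw [heu] at hpe
      rcases hp'.dvd_or_dvd hpe with h3 | h3
      · exact absurd (hp'.dvd_of_dvd_pow h3) (hp.not_dvd_two_of_ne h2)
      · exact (h3.mul_right _).mul_left _) hm.ne'
    exact ⟨_, (h'.reflectAt f 0).mem_curvatures i j, (Int.modEq_iff_dvd.2 hd).symm⟩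

end SquarePacking

theorem mainTheorem4 (A : SquarePacking) (hint : A.IsIntegral) (hprim : A.IsPrimitive)
    (htype : A.IsTypeOne ∨ A.IsFullType) :
    (∃ ε : ℤ, (ε = 1 ∨ ε = -1) ∧ A.HasChiTwo ε) ∧
    (A.HasChiTwo (-1) → (∀ n : ℤ, n ^ 2 ∉ A.curvatures) ∧ ¬ A.LocalGlobal) := by
  obtain ⟨δ, hδ, hg⟩ := SquarePacking.exists_good hint hprim htype
  obtain ⟨ε, hε⟩ := hg.exists_hasVal
  have hχ := SquarePacking.hasChiTwo_of_hasVal hδ hg hε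
  refine ⟨⟨ε, hg.hasVal_eq_one_or_neg_one hε, hχ⟩, fun hneg => ?_⟩
  have hbase : A.base (0, 0) ∈ A.circles := ⟨1, one_mem _, (0, 0), rfl⟩
  have hε' : ε = -1 := (hneg _ hbase ε).1 ((hχ _ hbase ε).2 rfl)
  rw [hε'] at hε
  have hsq := SquarePacking.sq_notMem_curvatures hδ hg hε
  refine ⟨hsq, ?_⟩
  rintro ⟨N, hN⟩
  have hconf : A.IsConfig δ := ⟨1, one_mem _, by simpa using hδ⟩
  obtain ⟨n, hn, hadm⟩ := hconf.exists_sq_isAdmissible hg N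
  exact hsq n (hN _ hn hadm)
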